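/- Consider the system $x_{t+1}=Ax_t+Bu_t+w_t$ with $x_t\in\mathbb R^n$, $u_t\in\mathbb R^m$, a fixed initial state $x_0$, and i.i.d. noise $(w_t)$ with finite fourth moment, mean $\bar w$ and covariance $W\succ 0$. Let $Q\succeq 0$, $R\succ 0$, let $(A,B)$ be controllable and $(A,Q^{1/2})$ observable, and let $\rho>0$. Put $$M_3=\mathbb E\big[(w_t-\bar w)(w_t-\bar w)^\top Q(w_t-\bar w)\big],\qquad m_4=\mathbb E\Big[\big((w_t-\bar w)^\top Q(w_t-\bar w)-\operatorname{tr}(WQ)\big)^2\Big],\qquad \bar\rho=\rho-m_4+4\operatorname{tr}\big((WQ)^2\big).$$ For an affine policy $u_t=-Kx_t+l$, written $X=[K,l]$ with $K\in\mathbb R^{m\times n}$, $l\in\mathbb R^m$, let $$J(X)=\lim_{T\to\infty}\frac1T\,\mathbb E\Big[\sum_{t=0}^{T-1}\big(x_t^\top Qx_t+u_t^\top Ru_t\big)\Big],\qquad J_c(X)=\lim_{T\to\infty}\frac1T\,\mathbb E\Big[\sum_{t=0}^{T-1}\big(4x_t^\top QWQx_t+4x_t^\top QM_3\big)\Big]$$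 (upper limits in $[-\infty,\infty]$ if the limit does not exist). Let $\mathcal S$ be the set of policies $[K,l]$ for which the spectral radius of $A-BK$ is less than $1$. For $X\in\mathcal S$ and $\mu\ge 0$ let $\mathcal L(X,\mu)=J(X)+\mu\,(J_c(X)-\bar\rho)$, and let $D(\mu)=\min_{X\in\mathcal S}\mathcal L(X,\mu)$. Assume Slater's condition: there is $\widetilde X\in\mathcal S$ with $J_c(\widetilde X)<\bar\rho$. Then there is no duality gap between the primal problem of minimizing $J(X)$ over all affine policies $X$ with $J_c(X)\le\bar\rho$ and the dual problem of maximizing $D(\mu)$ over $\mu\ge 0$: $$\min_{X:\,J_c(X)\le\bar\rho}J(X)=\max_{\mu\ge 0}D(\mu).$$ Here the limits defining $J(X)$ and $J_c(X)$ exist and are finite for every $X\in\mathcal S$, the minimum defining $D(\mu)$ is attained for every $\mu\ge 0$, the primal minimum is attained at a policy in $\mathcal S$, and the dual maximum is attained. -/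

import Mathlib

open MeasureTheory ProbabilityTheory Filter Topology
open scoped Matrix

noncomputable section

/-- The pair `(A, B)` is controllable: the Kalman matrix `[B, A B, …, A ^ (n - 1) B]` has
rank `n`. -/
def IsControllable {n m : ℕ} (A : Matrix (Fin n) (Fin n) ℝ) (B : Matrix (Fin n) (Fin m) ℝ) :
    Prop :=
  (Matrix.of fun (i : Fin n) (p : Fin n × Fin m) => (A ^ (p.1 : ℕ) * B) i p.2).rank = n

/-- The pair `(A, C)` is observable: the matrix with row blocks `C, C A, …, C A ^ (n - 1)` has
rank `n`. -/
def IsObservable {n p : ℕ} (A : Matrix (Fin n) (Fin n) ℝ) (C : Matrix (Fin p) (Fin n) ℝ) :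
    Prop :=
  (Matrix.of fun (r : Fin n × Fin p) (j : Fin n) => (C * A ^ (r.1 : ℕ)) r.2 j).rank = n

section
open scoped MatrixOrder

/-- The positive semidefinite square root of a positive semidefinite real matrix. -/
def psdSqrt {n : ℕ} (Q : Matrix (Fin n) (Fin n) ℝ) : Matrix (Fin n) (Fin n) ℝ :=
  CFC.sqrt Q

end

/-- A real square matrix is (Schur) stable if its spectral radius, i.e. the largest modulus of
its complex eigenvalues, is smaller than `1`. -/
def IsSchurStable {n : ℕ} (M : Matrix (Fin n) (Fin n) ℝ) : Prop :=
  spectralRadius ℂ (M.map (algebraMap ℝ ℂ)) < 1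

/-- A time-invariant affine policy `u = -K x + l`, encoded as the pair `(K, l)`. -/
abbrev AffinePolicy (n m : ℕ) : Type :=
  Matrix (Fin m) (Fin n) ℝ × (Fin m → ℝ)

/-- The data of a risk-constrained linear quadratic regulator on a sample space `Ω`: the
system matrices, the weights, the initial state, the noise sequence and the risk tolerance. -/
structure RCLQRData (n m : ℕ) (Ω : Type*) where
  A : Matrix (Fin n) (Fin n) ℝ
  B : Matrix (Fin n) (Fin m) ℝ
  Q : Matrix (Fin n) (Fin n) ℝ
  R : Matrix (Fin m) (Fin m) ℝ
  x₀ : Fin n → ℝ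
  w : ℕ → Ω → (Fin n → ℝ)
  ρ : ℝ

namespace RCLQRData

/-- The closed-loop state `x_{t+1} = A x_t + B u_t + w_t` with `u_t = -K x_t + l`. -/
def state {n m : ℕ} {Ω : Type*} (D : RCLQRData n m Ω) (X : AffinePolicy n m) :
    ℕ → Ω → (Fin n → ℝ)
  | 0, _ => D.x₀
  | t + 1, ω =>
      D.A *ᵥ D.state X t ω + D.B *ᵥ (-(X.1 *ᵥ D.state X t ω) + X.2) + D.w t ω

/-- The control input `u_t = -K x_t + l`. -/
def input {n m : ℕ} {Ω : Type*} (D : RCLQRData n m Ω) (X : AffinePolicy n m)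
    (t : ℕ) (ω : Ω) : Fin m → ℝ :=
  -(X.1 *ᵥ D.state X t ω) + X.2

/-- The noise mean `𝔼[w_t]` (the noise is stationary, so it is computed at time `0`). -/
def noiseMean {n m : ℕ} {Ω : Type*} [MeasurableSpace Ω] (D : RCLQRData n m Ω)
    (P : Measure Ω) : Fin n → ℝ :=
  ∫ ω, D.w 0 ω ∂P

/-- The centered noise at time `0`. -/
def centeredNoise {n m : ℕ} {Ω : Type*} [MeasurableSpace Ω] (D : RCLQRData n m Ω)
    (P : Measure Ω) (ω : Ω) : Fin n → ℝ :=
  D.w 0 ω - D.noiseMean P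

/-- The noise covariance `W`. -/
def W {n m : ℕ} {Ω : Type*} [MeasurableSpace Ω] (D : RCLQRData n m Ω)
    (P : Measure Ω) : Matrix (Fin n) (Fin n) ℝ :=
  Matrix.of fun i j => ∫ ω, D.centeredNoise P ω i * D.centeredNoise P ω j ∂P

/-- The vector `M₃ = 𝔼[(w - w̄) (w - w̄)ᵀ Q (w - w̄)]`. -/
def M₃ {n m : ℕ} {Ω : Type*} [MeasurableSpace Ω] (D : RCLQRData n m Ω)
    (P : Measure Ω) : Fin n → ℝ :=
  ∫ ω, (D.centeredNoise P ω ⬝ᵥ D.Q *ᵥ D.centeredNoise P ω) • D.centeredNoise P ω ∂P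

/-- The scalar `m₄ = 𝔼[((w - w̄)ᵀ Q (w - w̄) - tr (W Q)) ^ 2]`. -/
def m₄ {n m : ℕ} {Ω : Type*} [MeasurableSpace Ω] (D : RCLQRData n m Ω)
    (P : Measure Ω) : ℝ :=
  ∫ ω, (D.centeredNoise P ω ⬝ᵥ D.Q *ᵥ D.centeredNoise P ω - (D.W P * D.Q).trace) ^ 2 ∂P

/-- The risk level `ρ̄ = ρ - m₄ + 4 tr ((W Q) ^ 2)`. -/
def rhoBar {n m : ℕ} {Ω : Type*} [MeasurableSpace Ω] (D : RCLQRData n m Ω)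
    (P : Measure Ω) : ℝ :=
  D.ρ - D.m₄ P + 4 * ((D.W P * D.Q) ^ 2).trace

/-- The expected average cost over the horizon `T`:
`(1 / T) 𝔼[∑_{t < T} (x_tᵀ Q x_t + u_tᵀ R u_t)]`. -/
def avgCost {n m : ℕ} {Ω : Type*} [MeasurableSpace Ω] (D : RCLQRData n m Ω)
    (P : Measure Ω) (X : AffinePolicy n m) (T : ℕ) : ℝ :=
  (1 / (T : ℝ)) * ∫ ω, ∑ t ∈ Finset.range T,
    (D.state X t ω ⬝ᵥ D.Q *ᵥ D.state X t ω + D.input X t ω ⬝ᵥ D.R *ᵥ D.input X t ω) ∂P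

/-- The expected average risk over the horizon `T`:
`(1 / T) 𝔼[∑_{t < T} (4 x_tᵀ Q W Q x_t + 4 x_tᵀ Q M₃)]`. -/
def avgRisk {n m : ℕ} {Ω : Type*} [MeasurableSpace Ω] (D : RCLQRData n m Ω)
    (P : Measure Ω) (X : AffinePolicy n m) (T : ℕ) : ℝ :=
  (1 / (T : ℝ)) * ∫ ω, ∑ t ∈ Finset.range T,
    (4 * (D.state X t ω ⬝ᵥ (D.Q * D.W P * D.Q) *ᵥ D.state X t ω)
      + 4 * (D.state X t ω ⬝ᵥ D.Q *ᵥ D.M₃ P)) ∂P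

/-- The long-run average cost `J(K, l)`, an extended real number. The upper limit agrees with
the limit wherever the latter exists. -/
def J {n m : ℕ} {Ω : Type*} [MeasurableSpace Ω] (D : RCLQRData n m Ω)
    (P : Measure Ω) (X : AffinePolicy n m) : EReal :=
  limsup (fun T : ℕ => (D.avgCost P X T : EReal)) atTop

/-- The long-run average risk `J_c(K, l)`, an extended real number. The upper limit agrees with
the limit wherever the latter exists. -/
def Jc {n m : ℕ} {Ω : Type*} [MeasurableSpace Ω] (D : RCLQRData n m Ω)
    (P : Measure Ω) (X : AffinePolicy n m) : EReal :=
  limsup (fun T : ℕ => (D.avgRisk P X T : EReal)) atTop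

/-- The set `𝒮` of stabilizing affine policies: the spectral radius of `A - B K` is `< 1`. -/
def stabilizing {n m : ℕ} {Ω : Type*} (D : RCLQRData n m Ω) : Set (AffinePolicy n m) :=
  {X | IsSchurStable (D.A - D.B * X.1)}

/-- The Lagrangian `ℒ(X, μ) = J(X) + μ (J_c(X) - ρ̄)`. It is used for stabilizing `X` only,
where `J(X)` and `J_c(X)` are finite. -/
def lagrangian {n m : ℕ} {Ω : Type*} [MeasurableSpace Ω] (D : RCLQRData n m Ω)
    (P : Measure Ω) (X : AffinePolicy n m) (μ : ℝ) : EReal :=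
  D.J P X + (μ : EReal) * (D.Jc P X - (D.rhoBar P : EReal))

/-- The dual function: the least value of `ℒ(X, μ)` over stabilizing policies `X`. -/
def dualFun {n m : ℕ} {Ω : Type*} [MeasurableSpace Ω] (D : RCLQRData n m Ω)
    (P : Measure Ω) (μ : ℝ) : EReal :=
  ⨅ X ∈ D.stabilizing, D.lagrangian P X μ

/-- The optimal value of the primal problem: minimize `J(K, l)` over all affine policies
subject to `J_c(K, l) ≤ ρ̄`. -/
def primalValue {n m : ℕ} {Ω : Type*} [MeasurableSpace Ω] (D : RCLQRData n m Ω)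
    (P : Measure Ω) : EReal :=
  ⨅ X ∈ {X : AffinePolicy n m | D.Jc P X ≤ (D.rhoBar P : EReal)}, D.J P X

/-- The optimal value of the dual problem: maximize the dual function over `μ ≥ 0`. -/
def dualValue {n m : ℕ} {Ω : Type*} [MeasurableSpace Ω] (D : RCLQRData n m Ω)
    (P : Measure Ω) : EReal :=
  ⨆ μ ∈ Set.Ici (0 : ℝ), D.dualFun P μ

end RCLQRData

end

/-! The problem is not convex in the gain, but it is convex in the stationary moments. A stabilizing
policy has a limiting covariance S and mean x with S = (A - BK) S (A - BK)ᵀ + W and x = A x + B u +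
w̄, where u is the limiting mean input; the long-run cost and risk are explicit functions of (K, S,
x, u).

Three facts carry the proof. First, relaxation (`exists_stabilizing_le`): since W ≻ 0, any S ⪰ 0
with S ⪰ (A - BK) S (A - BK)ᵀ + W certifies that K is stabilizing and dominates the true stationary
covariance, and both rates increase with S. Second, convexity (`exists_stabilizing_convex`): in the
variables (KS, S, x, u) the relaxed constraint is convex, because (MS, S) ↦ M S Mᵀ is a matrix
perspective function; so the pairs (cost, risk) are convex up to domination. Third, compactness
(`exists_subseq_stabilizing`): observability bounds S and x by the cost, R ≻ 0 bounds u, and S ⪰ W ≻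
0 bounds K, so policies of bounded cost subconverge, and the limiting moments again certify a
stabilizing policy.

What remains is duality for two real functions with one constraint. Compactness, with the lower
bound `exists_le_riskLim` on the risk, gives both primal and dual-function minimizers; convexity and
Slater's condition give a multiplier (`ConvexlikePair.exists_multiplier`). The primal problem ranges
over all affine policies, but observability and W ≻ 0 make the cost of a non-stabilizing policy
infinite (`mem_stabilizing_of_J_lt_top`), so such policies do not compete. -/

noncomputable section

/-! ### Quadratic forms, traces, and Schur stability through powers. -/

section MatrixLemmas

variable {n m : ℕ}

section
open scoped MatrixOrder

theorem psdSqrt_transpose_mul_self {Q : Matrix (Fin n) (Fin n) ℝ} (hQ : Q.PosSemidef) :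
    (psdSqrt Q)ᵀ * psdSqrt Q = Q := by
  have h0 : (psdSqrt Q).PosSemidef := Matrix.nonneg_iff_posSemidef.1 (CFC.sqrt_nonneg Q)
  have h1 : (psdSqrt Q)ᵀ = psdSqrt Q := h0.isHermitian
  rw [h1]
  exact CFC.sqrt_mul_sqrt_self Q (Matrix.nonneg_iff_posSemidef.2 hQ)

end

theorem Matrix.PosSemidef.mul_mul_transpose {k : ℕ} {S : Matrix (Fin n) (Fin n) ℝ}
    (hS : S.PosSemidef) (F : Matrix (Fin k) (Fin n) ℝ) : (F * S * Fᵀ).PosSemidef :=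
  hS.mul_mul_conjTranspose_same F

/-- Writing S = CᵀC, cyclicity turns the trace into that of C T Cᵀ. This is what makes the cost and
risk rates monotone in the covariance. -/
theorem Matrix.PosSemidef.trace_mul_nonneg {S T : Matrix (Fin n) (Fin n) ℝ}
    (hS : S.PosSemidef) (hT : T.PosSemidef) : 0 ≤ (S * T).trace := by
  rw [← psdSqrt_transpose_mul_self hS, Matrix.mul_assoc, Matrix.trace_mul_comm]
  exact (hT.mul_mul_transpose (psdSqrt S)).trace_nonneg

theorem Matrix.PosSemidef.dotProduct_nonneg {S : Matrix (Fin n) (Fin n) ℝ}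
    (hS : S.PosSemidef) (x : Fin n → ℝ) : 0 ≤ x ⬝ᵥ S *ᵥ x :=
  hS.dotProduct_mulVec_nonneg x

/-- The form attains a positive minimum on the compact unit sphere. The norm here is the sup norm,
so comparing with x ⬝ᵥ x costs a factor n. -/
theorem Matrix.exists_mul_dotProduct_le_of_pos {S : Matrix (Fin n) (Fin n) ℝ}
    (hS : ∀ x : Fin n → ℝ, x ≠ 0 → 0 < x ⬝ᵥ S *ᵥ x) :
    ∃ c : ℝ, 0 < c ∧ ∀ x : Fin n → ℝ, c * (x ⬝ᵥ x) ≤ x ⬝ᵥ S *ᵥ x := by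
  rcases Nat.eq_zero_or_pos n with rfl | hn
  · exact ⟨1, one_pos, fun x => by simp [dotProduct]⟩
  have : Nonempty (Fin n) := ⟨⟨0, hn⟩⟩
  have hcpt : IsCompact (Metric.sphere (0 : Fin n → ℝ) 1) := isCompact_sphere _ _
  have hne : (Metric.sphere (0 : Fin n → ℝ) 1).Nonempty :=
    NormedSpace.sphere_nonempty.2 zero_le_one
  have hcont : Continuous fun x : Fin n → ℝ => x ⬝ᵥ S *ᵥ x := by fun_prop
  obtain ⟨y, hy, hmin⟩ := hcpt.exists_isMinOn hne hcont.continuousOn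
  have hy0 : y ≠ 0 := by
    rintro rfl
    simp at hy
  have hypos := hS y hy0
  have hn' : (0 : ℝ) < n := by exact_mod_cast hn
  refine ⟨(y ⬝ᵥ S *ᵥ y) / n, div_pos hypos hn', fun x => ?_⟩
  rcases eq_or_ne x 0 with rfl | hx
  · simp
  have hnx : 0 < ‖x‖ := norm_pos_iff.2 hx
  have h1 : y ⬝ᵥ S *ᵥ y ≤ (‖x‖⁻¹ • x) ⬝ᵥ S *ᵥ (‖x‖⁻¹ • x) := by
    apply hmin
    simp [norm_smul, hnx.ne']
  have h2 : x ⬝ᵥ x ≤ n * ‖x‖ ^ 2 := by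
    calc x ⬝ᵥ x = ∑ i, x i * x i := rfl
      _ ≤ ∑ _i : Fin n, ‖x‖ ^ 2 := by
        refine Finset.sum_le_sum fun i _ => ?_
        have := norm_le_pi_norm x i
        rw [← pow_two, ← sq_abs]
        exact pow_le_pow_left₀ (abs_nonneg _) this 2
      _ = _ := by simp
  have h3 : (‖x‖⁻¹ • x) ⬝ᵥ S *ᵥ (‖x‖⁻¹ • x) = (x ⬝ᵥ S *ᵥ x) / ‖x‖ ^ 2 := by
    simp only [Matrix.mulVec_smul, smul_dotProduct, dotProduct_smul, smul_eq_mul]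
    field_simp
  rw [h3, le_div_iff₀ (by positivity)] at h1
  calc (y ⬝ᵥ S *ᵥ y) / n * (x ⬝ᵥ x) ≤ (y ⬝ᵥ S *ᵥ y) / n * (n * ‖x‖ ^ 2) := by gcongr
    _ = (y ⬝ᵥ S *ᵥ y) * ‖x‖ ^ 2 := by field_simp
    _ ≤ _ := h1

theorem Matrix.PosDef.exists_mul_dotProduct_le {S : Matrix (Fin n) (Fin n) ℝ}
    (hS : S.PosDef) : ∃ c : ℝ, 0 < c ∧ ∀ x : Fin n → ℝ, c * (x ⬝ᵥ x) ≤ x ⬝ᵥ S *ᵥ x :=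
  Matrix.exists_mul_dotProduct_le_of_pos fun _ hx => hS.dotProduct_mulVec_pos hx

theorem dotProduct_mulVec_eq_sum (S : Matrix (Fin n) (Fin n) ℝ) (x y : Fin n → ℝ) :
    x ⬝ᵥ S *ᵥ y = ∑ i, ∑ j, S i j * (x i * y j) := by
  simp only [dotProduct, Matrix.mulVec, Finset.mul_sum]
  refine Finset.sum_congr rfl fun i _ => Finset.sum_congr rfl fun j _ => by ring

theorem Matrix.exists_dotProduct_mulVec_le (S : Matrix (Fin n) (Fin n) ℝ) :
    ∃ c : ℝ, 0 < c ∧ ∀ x : Fin n → ℝ, x ⬝ᵥ S *ᵥ x ≤ c * (x ⬝ᵥ x) := by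
  refine ⟨(∑ i, ∑ j, |S i j|) + 1, by positivity, fun x => ?_⟩
  have hx : ∀ i, x i * x i ≤ x ⬝ᵥ x := fun i =>
    Finset.single_le_sum (f := fun i => x i * x i) (fun i _ => mul_self_nonneg _)
      (Finset.mem_univ i)
  have hxx : 0 ≤ x ⬝ᵥ x := Finset.sum_nonneg fun i _ => mul_self_nonneg _
  calc x ⬝ᵥ S *ᵥ x = ∑ i, ∑ j, S i j * (x i * x j) := dotProduct_mulVec_eq_sum S x x
    _ ≤ ∑ i, ∑ j, |S i j| * (x ⬝ᵥ x) := by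
      refine Finset.sum_le_sum fun i _ => Finset.sum_le_sum fun j _ => ?_
      refine (le_abs_self _).trans ?_
      rw [abs_mul]
      refine mul_le_mul_of_nonneg_left ?_ (abs_nonneg _)
      rw [abs_le]
      constructor <;> nlinarith [hx i, hx j, sq_nonneg (x i + x j), sq_nonneg (x i - x j)]
    _ = (∑ i, ∑ j, |S i j|) * (x ⬝ᵥ x) := by simp only [Finset.sum_mul]
    _ ≤ _ := by nlinarith

theorem Matrix.exists_mulVec_dotProduct_le {k : ℕ} (F : Matrix (Fin k) (Fin n) ℝ) :
    ∃ c : ℝ, 0 < c ∧ ∀ x : Fin n → ℝ, F *ᵥ x ⬝ᵥ F *ᵥ x ≤ c * (x ⬝ᵥ x) := by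
  obtain ⟨c, hc, h⟩ := Matrix.exists_dotProduct_mulVec_le (Fᵀ * F)
  refine ⟨c, hc, fun x => ?_⟩
  convert h x using 1
  rw [← Matrix.mulVec_mulVec, Matrix.dotProduct_mulVec, Matrix.dotProduct_mulVec x,
    Matrix.vecMul_transpose, Matrix.dotProduct_mulVec]

theorem real_dotProduct_self_nonneg (x : Fin n → ℝ) : 0 ≤ x ⬝ᵥ x :=
  Finset.sum_nonneg fun _ _ => mul_self_nonneg _

/-- A positive semidefinite quadratic form satisfies `q (x - y) ≤ 2 q x + 2 q y`. -/
theorem Matrix.PosSemidef.dotProduct_sub_le {S : Matrix (Fin n) (Fin n) ℝ}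
    (hS : S.PosSemidef) (x y : Fin n → ℝ) :
    (x - y) ⬝ᵥ S *ᵥ (x - y) ≤ 2 * (x ⬝ᵥ S *ᵥ x) + 2 * (y ⬝ᵥ S *ᵥ y) := by
  have h := hS.dotProduct_nonneg (x + y)
  simp only [Matrix.mulVec_add, Matrix.mulVec_sub, add_dotProduct, sub_dotProduct,
    dotProduct_add, dotProduct_sub] at h ⊢
  linarith

theorem Matrix.PosSemidef.dotProduct_convex {S : Matrix (Fin n) (Fin n) ℝ}
    (hS : S.PosSemidef) {a b : ℝ} (ha : 0 ≤ a) (hb : 0 ≤ b) (hab : a + b = 1)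
    (x y : Fin n → ℝ) :
    (a • x + b • y) ⬝ᵥ S *ᵥ (a • x + b • y) ≤ a * (x ⬝ᵥ S *ᵥ x) + b * (y ⬝ᵥ S *ᵥ y) := by
  have h := mul_nonneg (mul_nonneg ha hb) (hS.dotProduct_nonneg (x - y))
  obtain rfl : b = 1 - a := by linarith
  simp only [Matrix.mulVec_add, Matrix.mulVec_sub, add_dotProduct, sub_dotProduct,
    dotProduct_add, dotProduct_sub, Matrix.mulVec_smul, smul_dotProduct, dotProduct_smul,
    smul_eq_mul] at h ⊢
  linarith

theorem trace_mul_mul_transpose_eq_sum {k : ℕ} (S : Matrix (Fin n) (Fin n) ℝ)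
    (G : Matrix (Fin k) (Fin n) ℝ) :
    (G * S * Gᵀ).trace = ∑ i, G i ⬝ᵥ S *ᵥ G i := by
  simp only [Matrix.trace, Matrix.diag]
  refine Finset.sum_congr rfl fun i _ => ?_
  rw [dotProduct_mulVec_eq_sum, Matrix.mul_apply, Finset.sum_comm]
  refine Finset.sum_congr rfl fun j _ => ?_
  rw [Matrix.mul_apply, Finset.sum_mul]
  refine Finset.sum_congr rfl fun l _ => ?_
  rw [Matrix.transpose_apply]
  ring

/-- The trace is the sum of the form S over the rows of G. The constant depends on S alone, so it
serves both for powers of a closed-loop matrix and for gains. -/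
theorem Matrix.PosDef.exists_sq_entry_le {S : Matrix (Fin n) (Fin n) ℝ} (hS : S.PosDef) :
    ∃ c : ℝ, 0 < c ∧ ∀ (k : ℕ) (G : Matrix (Fin k) (Fin n) ℝ) (i : Fin k) (j : Fin n),
      G i j ^ 2 ≤ c * (G * S * Gᵀ).trace := by
  obtain ⟨c, hc, h⟩ := hS.exists_mul_dotProduct_le
  refine ⟨c⁻¹, inv_pos.2 hc, fun k G i j => ?_⟩
  rw [trace_mul_mul_transpose_eq_sum, le_inv_mul_iff₀ hc]
  calc c * G i j ^ 2 ≤ c * (G i ⬝ᵥ G i) := by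
        refine mul_le_mul_of_nonneg_left ?_ hc.le
        rw [pow_two]
        exact Finset.single_le_sum (f := fun j => G i j * G i j)
          (fun i _ => mul_self_nonneg _) (Finset.mem_univ j)
    _ ≤ G i ⬝ᵥ S *ᵥ G i := h _
    _ ≤ _ := Finset.single_le_sum (f := fun i => G i ⬝ᵥ S *ᵥ G i)
          (fun i _ => hS.posSemidef.dotProduct_nonneg _) (Finset.mem_univ i)

section
attribute [local instance] Matrix.frobeniusNormedRing Matrix.frobeniusNormedAlgebra

theorem Matrix.norm_entry_le_frobenius_norm (M : Matrix (Fin n) (Fin n) ℂ) (i j : Fin n) :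
    ‖M i j‖ ≤ ‖M‖ := by
  rw [Matrix.frobenius_norm_def, ← Real.sqrt_eq_rpow]
  refine Real.le_sqrt_of_sq_le ?_
  have h1 := Finset.single_le_sum (f := fun j => ‖M i j‖ ^ (2 : ℝ))
    (fun i _ => by positivity) (Finset.mem_univ j)
  have h2 := Finset.single_le_sum (f := fun i => ∑ j, ‖M i j‖ ^ (2 : ℝ))
    (fun i _ => by positivity) (Finset.mem_univ i)
  simpa using h1.trans h2

/-- Gelfand's formula, with r strictly between the spectral radius and 1; no multiplicative constant
is needed because the bound is only eventual. -/
theorem IsSchurStable.exists_abs_pow_apply_le {F : Matrix (Fin n) (Fin n) ℝ}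
    (hF : IsSchurStable F) :
    ∃ r : ℝ, 0 ≤ r ∧ r < 1 ∧ ∀ᶠ k in atTop, ∀ i j, |(F ^ k) i j| ≤ r ^ k := by
  have : CompleteSpace (Matrix (Fin n) (Fin n) ℂ) := FiniteDimensional.complete ℂ _
  have h := spectrum.pow_norm_pow_one_div_tendsto_nhds_spectralRadius
    (F.map (algebraMap ℝ ℂ))
  obtain ⟨r, hr0, hr1, hr2⟩ := ENNReal.lt_iff_exists_real_btwn.1 hF
  refine ⟨r, hr0, by simpa using hr2, ?_⟩
  filter_upwards [h.eventually_lt_const hr1, eventually_ge_atTop 1] with k hk hk1 i j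
  have hk0 : (k : ℝ) ≠ 0 := by exact_mod_cast (by omega : k ≠ 0)
  have h1 := (ENNReal.ofReal_lt_ofReal_iff_of_nonneg (by positivity)).1 hk
  have h2 : ‖(F.map (algebraMap ℝ ℂ)) ^ k‖ ≤ r ^ k := by
    have := pow_le_pow_left₀ (by positivity) h1.le k
    rwa [← Real.rpow_natCast, ← Real.rpow_mul (norm_nonneg _), one_div, inv_mul_cancel₀ hk0,
      Real.rpow_one] at this
  rw [← Matrix.map_pow] at h2
  have h3 := (Matrix.norm_entry_le_frobenius_norm _ i j).trans h2
  simpa using h3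

theorem isSchurStable_of_tendsto_pow {F : Matrix (Fin n) (Fin n) ℝ}
    (hF : ∀ i j, Tendsto (fun k => (F ^ k) i j) atTop (𝓝 0)) : IsSchurStable F := by
  have : CompleteSpace (Matrix (Fin n) (Fin n) ℂ) := FiniteDimensional.complete ℂ _
  -- The identity need not have Frobenius norm 1, so its norm stays as a factor in the bound of the
  -- spectral radius by roots of norms of powers.
  have hn : Tendsto (fun k => ‖(F.map (algebraMap ℝ ℂ)) ^ k‖₊ * ‖(1 : Matrix (Fin n) (Fin n) ℂ)‖₊)
      atTop (𝓝 0) := by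
    have h1 : Tendsto (fun k => ‖(F.map (algebraMap ℝ ℂ)) ^ k‖₊) atTop (𝓝 0) := by
      simp_rw [← Matrix.map_pow, Matrix.frobenius_nnnorm_def]
      have h2 : ∀ i j, Tendsto (fun k => ‖((F ^ k).map (algebraMap ℝ ℂ)) i j‖₊ ^ (2 : ℝ))
          atTop (𝓝 0) := fun i j => by
        have h3 : Tendsto (fun k => ‖((F ^ k).map (algebraMap ℝ ℂ)) i j‖₊) atTop (𝓝 0) := by
          simpa using (hF i j).nnnorm
        simpa using h3.nnrpow tendsto_const_nhds (Or.inr two_pos)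
      have h4 := tendsto_finsetSum Finset.univ fun i _ =>
        tendsto_finsetSum Finset.univ fun j _ => h2 i j
      simpa using h4.nnrpow tendsto_const_nhds (Or.inr one_half_pos)
    simpa using h1.mul_const _
  obtain ⟨k, hk⟩ := (((tendsto_add_atTop_iff_nat 1).2 hn).eventually_lt_const one_pos).exists
  refine (spectrum.spectralRadius_le_pow_nnnorm_pow_one_div ℂ _ k).trans_lt ?_
  rw [← ENNReal.mul_rpow_of_nonneg _ _ (by positivity)]
  exact ENNReal.rpow_lt_one (by exact_mod_cast hk) (by positivity)
end
end MatrixLemmas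

/-! ### Covariance and mean recursions, and Lyapunov's criterion. -/

section StateMoments

variable {n : ℕ}

/-- The covariance recursion `S₀ = 0`, `S_{t+1} = F S_t Fᵀ + W`. -/
def stateCov (F W : Matrix (Fin n) (Fin n) ℝ) : ℕ → Matrix (Fin n) (Fin n) ℝ
  | 0 => 0
  | t + 1 => F * stateCov F W t * Fᵀ + W

/-- The mean recursion `m_{t+1} = F m_t + b`. -/
def stateMean (F : Matrix (Fin n) (Fin n) ℝ) (b x₀ : Fin n → ℝ) : ℕ → Fin n → ℝ
  | 0 => x₀
  | t + 1 => F *ᵥ stateMean F b x₀ t + b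

theorem stateCov_eq_sum (F W : Matrix (Fin n) (Fin n) ℝ) (t : ℕ) :
    stateCov F W t = ∑ k ∈ Finset.range t, F ^ k * W * (F ^ k)ᵀ := by
  induction t with
  | zero => simp [stateCov]
  | succ t ih =>
    rw [stateCov, ih, Finset.sum_range_succ', Finset.mul_sum, Finset.sum_mul]
    simp [pow_succ', Matrix.transpose_mul, Matrix.mul_assoc]

theorem stateCov_posSemidef (F : Matrix (Fin n) (Fin n) ℝ) {W : Matrix (Fin n) (Fin n) ℝ}
    (hW : W.PosSemidef) (t : ℕ) : (stateCov F W t).PosSemidef := by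
  induction t with
  | zero => exact Matrix.PosSemidef.zero
  | succ t ih => exact (ih.mul_mul_transpose F).add hW

/-- The map S ↦ F S Fᵀ + W is monotone, so a supersolution lies above every iterate started from 0.
-/
theorem posSemidef_sub_stateCov {F W S : Matrix (Fin n) (Fin n) ℝ} (hS : S.PosSemidef)
    (h : (S - F * S * Fᵀ - W).PosSemidef) (t : ℕ) : (S - stateCov F W t).PosSemidef := by
  induction t with
  | zero => simpa [stateCov] using hS
  | succ t ih =>
    have := h.add (ih.mul_mul_transpose F)
    convert this using 1
    rw [stateCov, Matrix.mul_sub, Matrix.sub_mul]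
    abel

theorem trace_stateCov_mono (F : Matrix (Fin n) (Fin n) ℝ) {W : Matrix (Fin n) (Fin n) ℝ}
    (hW : W.PosSemidef) : Monotone fun t => (stateCov F W t).trace := by
  refine monotone_nat_of_le_succ fun t => ?_
  rw [stateCov_eq_sum, stateCov_eq_sum, Finset.sum_range_succ, Matrix.trace_add]
  exact le_add_of_nonneg_right (hW.mul_mul_transpose _).trace_nonneg

/-- The traces are partial sums of the nonnegative series of tr(Fᵏ W (Fᵏ)ᵀ). If they are bounded,
its terms tend to 0, and W ≻ 0 forces Fᵏ → 0. -/
theorem isSchurStable_of_trace_stateCov_le {F W : Matrix (Fin n) (Fin n) ℝ} (hW : W.PosDef)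
    {C : ℝ} (h : ∀ t, (stateCov F W t).trace ≤ C) : IsSchurStable F := by
  obtain ⟨c, hc, hle⟩ := hW.exists_sq_entry_le
  have hsum : Summable fun k => (F ^ k * W * (F ^ k)ᵀ).trace := by
    refine summable_of_sum_range_le (c := C)
      (fun k => (hW.posSemidef.mul_mul_transpose _).trace_nonneg) fun t => ?_
    rw [← Matrix.trace_sum, ← stateCov_eq_sum]
    exact h t
  refine isSchurStable_of_tendsto_pow fun i j => ?_
  have h1 : Tendsto (fun k => (F ^ k) i j ^ 2) atTop (𝓝 0) :=
    squeeze_zero (fun k => sq_nonneg _) (fun k => hle n (F ^ k) i j)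
      (by simpa using hsum.tendsto_atTop_zero.const_mul c)
  have h2 := h1.sqrt
  simp only [Real.sqrt_sq_eq_abs, Real.sqrt_zero] at h2
  exact (tendsto_zero_iff_abs_tendsto_zero _).2 h2

theorem isSchurStable_of_posSemidef {F W S : Matrix (Fin n) (Fin n) ℝ} (hW : W.PosDef)
    (hS : S.PosSemidef) (h : (S - F * S * Fᵀ - W).PosSemidef) : IsSchurStable F := by
  refine isSchurStable_of_trace_stateCov_le hW (C := S.trace) fun t => ?_
  have := (posSemidef_sub_stateCov hS h t).trace_nonneg
  rw [Matrix.trace_sub] at this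
  linarith

theorem IsSchurStable.tendsto_pow {F : Matrix (Fin n) (Fin n) ℝ} (hF : IsSchurStable F) :
    Tendsto (fun k => F ^ k) atTop (𝓝 0) := by
  obtain ⟨r, hr0, hr1, hr⟩ := hF.exists_abs_pow_apply_le
  refine tendsto_pi_nhds.2 fun i => tendsto_pi_nhds.2 fun j => ?_
  refine squeeze_zero_norm' (a := fun k => r ^ k) ?_ (tendsto_pow_atTop_nhds_zero_of_lt_one hr0 hr1)
  filter_upwards [hr] with k hk
  exact hk i j

theorem IsSchurStable.exists_tendsto_stateCov {F : Matrix (Fin n) (Fin n) ℝ}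
    (hF : IsSchurStable F) (W : Matrix (Fin n) (Fin n) ℝ) :
    ∃ S, Tendsto (stateCov F W) atTop (𝓝 S) := by
  obtain ⟨r, hr0, hr1, hr⟩ := hF.exists_abs_pow_apply_le
  have hs : ∀ i j : Fin n, Summable fun k : ℕ => (F ^ k * W * (F ^ k)ᵀ) i j := fun i j => by
    have hr2 : r * r < 1 := by nlinarith
    refine Summable.of_norm_bounded_eventually_nat (g := fun k => (∑ a, ∑ b, |W a b|) * (r * r) ^ k)
      ((summable_geometric_of_lt_one (by positivity) hr2).mul_left _) ?_
    filter_upwards [hr] with k hk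
    simp only [Matrix.mul_apply, Matrix.transpose_apply, Finset.sum_mul]
    rw [Finset.sum_comm]
    refine (norm_sum_le _ _).trans (Finset.sum_le_sum fun a _ => (norm_sum_le _ _).trans
      (Finset.sum_le_sum fun b _ => ?_))
    rw [Real.norm_eq_abs, abs_mul, abs_mul, mul_pow]
    have h1 := hk i a
    have h2 := hk j b
    calc |(F ^ k) i a| * |W a b| * |(F ^ k) j b| ≤ r ^ k * |W a b| * r ^ k := by gcongr
      _ = _ := by ring
  refine ⟨Matrix.of fun i j => ∑' k : ℕ, (F ^ k * W * (F ^ k)ᵀ) i j, ?_⟩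
  refine tendsto_pi_nhds.2 fun i => tendsto_pi_nhds.2 fun j => ?_
  have := (hs i j).hasSum.tendsto_sum_nat
  refine this.congr fun t => ?_
  rw [stateCov_eq_sum, Matrix.sum_apply]

theorem eq_of_tendsto_stateCov {F W S : Matrix (Fin n) (Fin n) ℝ}
    (h : Tendsto (stateCov F W) atTop (𝓝 S)) : S = F * S * Fᵀ + W := by
  have h1 : Tendsto (fun t => stateCov F W (t + 1)) atTop (𝓝 S) :=
    (tendsto_add_atTop_iff_nat 1).2 h
  refine tendsto_nhds_unique h1 ?_
  exact ((continuous_const.mul continuous_id |>.mul continuous_const |>.add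
    continuous_const : Continuous fun M : Matrix (Fin n) (Fin n) ℝ => F * M * Fᵀ + W).tendsto S).comp h

theorem Matrix.PosSemidef.of_tendsto {ι : Type*} {l : Filter ι} [l.NeBot]
    {u : ι → Matrix (Fin n) (Fin n) ℝ} {S : Matrix (Fin n) (Fin n) ℝ}
    (hu : Tendsto u l (𝓝 S)) (h : ∀ i, (u i).PosSemidef) : S.PosSemidef := by
  refine Matrix.PosSemidef.of_dotProduct_mulVec_nonneg ?_ fun x => ?_
  · have h1 : Tendsto (fun i => (u i)ᴴ) l (𝓝 Sᴴ) :=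
      (continuous_id.matrix_conjTranspose.tendsto S).comp hu
    refine tendsto_nhds_unique h1 (hu.congr fun i => ?_)
    exact (h i).isHermitian.symm
  · have h1 : Continuous fun M : Matrix (Fin n) (Fin n) ℝ => star x ⬝ᵥ M *ᵥ x := by fun_prop
    exact ge_of_tendsto' ((h1.tendsto S).comp hu) fun i => (h i).dotProduct_mulVec_nonneg x

/-- A vector in the kernel of 1 - F is fixed by every Fᵏ, and Fᵏ → 0; hence 1 - F is injective, so
surjective. -/
theorem IsSchurStable.exists_fixedPoint {F : Matrix (Fin n) (Fin n) ℝ}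
    (hF : IsSchurStable F) (b : Fin n → ℝ) : ∃ x, x = F *ᵥ x + b := by
  have hinj : Function.Injective ((1 - F).toLin') := by
    rw [← LinearMap.ker_eq_bot, LinearMap.ker_eq_bot']
    intro v hv
    have hv1 : F *ᵥ v = v := by
      rw [Matrix.toLin'_apply, Matrix.sub_mulVec, Matrix.one_mulVec, sub_eq_zero] at hv
      exact hv.symm
    have hv2 : ∀ k : ℕ, (F ^ k) *ᵥ v = v := fun k => by
      induction k with
      | zero => simp
      | succ k ih => rw [pow_succ, ← Matrix.mulVec_mulVec, hv1, ih]
    have h1 : Continuous fun M : Matrix (Fin n) (Fin n) ℝ => M *ᵥ v := by fun_prop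
    have h2 := (h1.tendsto 0).comp hF.tendsto_pow
    simp only [Function.comp_def, hv2, Matrix.zero_mulVec] at h2
    exact tendsto_nhds_unique tendsto_const_nhds h2
  obtain ⟨x, hx⟩ := LinearMap.injective_iff_surjective.1 hinj b
  refine ⟨x, ?_⟩
  rw [Matrix.toLin'_apply, Matrix.sub_mulVec, Matrix.one_mulVec] at hx
  rw [← hx]
  abel

theorem IsSchurStable.tendsto_stateMean {F : Matrix (Fin n) (Fin n) ℝ}
    (hF : IsSchurStable F) {b x : Fin n → ℝ} (hx : x = F *ᵥ x + b) (x₀ : Fin n → ℝ) :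
    Tendsto (stateMean F b x₀) atTop (𝓝 x) := by
  have h0 : ∀ t, stateMean F b x₀ t = (F ^ t) *ᵥ (x₀ - x) + x := fun t => by
    induction t with
    | zero => simp [stateMean]
    | succ t ih =>
      rw [stateMean, ih, pow_succ', ← Matrix.mulVec_mulVec, Matrix.mulVec_add, add_assoc, ← hx]
  have h1 : Continuous fun M : Matrix (Fin n) (Fin n) ℝ => M *ᵥ (x₀ - x) + x := by fun_prop
  have h2 := (h1.tendsto 0).comp hF.tendsto_pow
  simp only [Matrix.zero_mulVec, zero_add] at h2
  exact h2.congr fun t => (h0 t).symm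

end StateMoments

/-! ### Second moments of a linear system driven by white noise. -/

section WhiteNoise

variable {n m : ℕ} {Ω : Type*}

/-- The response of `e_{t+1} = F e_t + ξ_t` to the noise `ξ`, from rest. -/
def noiseResponse (F : Matrix (Fin n) (Fin n) ℝ) (ξ : ℕ → Ω → Fin n → ℝ) :
    ℕ → Ω → Fin n → ℝ
  | 0, _ => 0
  | t + 1, ω => F *ᵥ noiseResponse F ξ t ω + ξ t ω

theorem dotProduct_noiseResponse_succ (F : Matrix (Fin n) (Fin n) ℝ) (ξ : ℕ → Ω → Fin n → ℝ)
    (u : Fin n → ℝ) (t : ℕ) (ω : Ω) :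
    u ⬝ᵥ noiseResponse F ξ (t + 1) ω = (Fᵀ *ᵥ u) ⬝ᵥ noiseResponse F ξ t ω + u ⬝ᵥ ξ t ω := by
  rw [noiseResponse, dotProduct_add, Matrix.dotProduct_mulVec, Matrix.mulVec_transpose]

variable [MeasurableSpace Ω] {P : Measure Ω}

/-- Square integrable, centered, pairwise uncorrelated vectors with common covariance `W`. -/
structure IsWhiteNoise (P : Measure Ω) (ξ : ℕ → Ω → Fin n → ℝ)
    (W : Matrix (Fin n) (Fin n) ℝ) : Prop where
  memLp : ∀ t u, MemLp (fun ω => u ⬝ᵥ ξ t ω) 2 P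
  mean : ∀ t u, ∫ ω, u ⬝ᵥ ξ t ω ∂P = 0
  cov_self : ∀ t u v, ∫ ω, (u ⬝ᵥ ξ t ω) * (v ⬝ᵥ ξ t ω) ∂P = u ⬝ᵥ W *ᵥ v
  cov_ne : ∀ s t, s ≠ t → ∀ u v, ∫ ω, (u ⬝ᵥ ξ s ω) * (v ⬝ᵥ ξ t ω) ∂P = 0

theorem MeasureTheory.MemLp.dotProduct {p : ENNReal} {f : Ω → Fin n → ℝ} (hf : MemLp f p P)
    (u : Fin n → ℝ) : MemLp (fun ω => u ⬝ᵥ f ω) p P := by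
  simp only [dotProduct_comm u]
  exact memLp_finsetSum _ fun i _ => (memLp_pi_iff.1 hf i).mul_const (u i)

namespace RCLQRData

/-- Identical distribution transports means and covariances to time 0, and independence removes the
cross terms. The moment computations below use only this second-order structure. -/
theorem isWhiteNoise [IsProbabilityMeasure P] (D : RCLQRData n m Ω)
    (hw_meas : ∀ t, Measurable (D.w t))
    (hw_indep : iIndepFun D.w P)
    (hw_ident : ∀ t, IdentDistrib (D.w t) (D.w 0) P P)
    (hw_moment : MemLp (D.w 0) 2 P) :
    IsWhiteNoise P (fun t ω => D.w t ω - D.noiseMean P) (D.W P) := by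
  have hmeas : ∀ u : Fin n → ℝ, Measurable fun x : Fin n → ℝ => u ⬝ᵥ (x - D.noiseMean P) :=
    fun u => by
      have : Continuous fun x : Fin n → ℝ => u ⬝ᵥ (x - D.noiseMean P) := by fun_prop
      exact this.measurable
  have hmem : ∀ t, MemLp (D.w t) 2 P := fun t => (hw_ident t).symm.memLp_snd hw_moment
  have hmemc : ∀ t, MemLp (fun ω => D.w t ω - D.noiseMean P) 2 P := fun t =>
    (hmem t).sub (memLp_const _)
  have hmean : ∀ t u, ∫ ω, u ⬝ᵥ (D.w t ω - D.noiseMean P) ∂P = 0 := fun t u => by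
    have h1 := ((hw_ident t).comp (hmeas u)).integral_eq
    simp only [Function.comp_def] at h1
    rw [h1]
    have hi : ∀ i, Integrable (fun ω => D.w 0 ω i) P := fun i =>
      (memLp_pi_iff.1 hw_moment i).integrable one_le_two
    have h2 : ∀ i, ∫ ω, (D.w 0 ω - D.noiseMean P) i ∂P = 0 := fun i => by
      simp only [Pi.sub_apply]
      rw [integral_sub (hi i) (integrable_const _), noiseMean, eval_integral hi]
      simp
    simp only [dotProduct]
    rw [integral_finsetSum _ fun i _ => ?_]
    · simp only [integral_const_mul, h2, mul_zero, Finset.sum_const_zero]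
    · exact ((hi i).sub (integrable_const _)).const_mul _
  refine ⟨fun t u => (hmemc t).dotProduct u, hmean, fun t u v => ?_, fun s t hst u v => ?_⟩
  · have h1 := ((hw_ident t).comp ((hmeas u).mul (hmeas v))).integral_eq
    simp only [Function.comp_def, Pi.mul_apply] at h1
    rw [h1, dotProduct_mulVec_eq_sum]
    have hi : ∀ i j, Integrable (fun ω => D.centeredNoise P ω i * D.centeredNoise P ω j) P :=
      fun i j => (memLp_pi_iff.1 (hmemc 0) i).integrable_mul (memLp_pi_iff.1 (hmemc 0) j)
    have h2 : ∀ ω, (u ⬝ᵥ (D.w 0 ω - D.noiseMean P)) * (v ⬝ᵥ (D.w 0 ω - D.noiseMean P)) =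
        ∑ i, ∑ j, (u i * v j) * (D.centeredNoise P ω i * D.centeredNoise P ω j) := fun ω => by
      simp only [dotProduct, centeredNoise, Finset.sum_mul_sum]
      refine Finset.sum_congr rfl fun i _ => Finset.sum_congr rfl fun j _ => by ring
    simp only [h2]
    rw [integral_finsetSum _ fun i _ => integrable_finsetSum _ fun j _ => (hi i j).const_mul _]
    refine Finset.sum_congr rfl fun i _ => ?_
    rw [integral_finsetSum _ fun j _ => (hi i j).const_mul _]
    refine Finset.sum_congr rfl fun j _ => ?_
    rw [integral_const_mul, mul_comm]
    rfl
  · have h1 := (hw_indep.indepFun hst).comp (hmeas u) (hmeas v)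
    have h2 := h1.integral_fun_mul_eq_mul_integral
      ((hmeas u).comp (hw_meas s)).aestronglyMeasurable
      ((hmeas v).comp (hw_meas t)).aestronglyMeasurable
    simp only [Function.comp_def] at h2
    rw [h2, hmean, zero_mul]

end RCLQRData

namespace IsWhiteNoise

variable {ξ : ℕ → Ω → Fin n → ℝ} {W : Matrix (Fin n) (Fin n) ℝ}

theorem memLp_noiseResponse [IsProbabilityMeasure P] (h : IsWhiteNoise P ξ W)
    (F : Matrix (Fin n) (Fin n) ℝ) (t : ℕ) (u : Fin n → ℝ) :
    MemLp (fun ω => u ⬝ᵥ noiseResponse F ξ t ω) 2 P := by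
  induction t generalizing u with
  | zero => simp [noiseResponse]
  | succ t ih =>
    simp only [dotProduct_noiseResponse_succ]
    exact (ih _).add (h.memLp t u)

theorem integral_noiseResponse [IsProbabilityMeasure P] (h : IsWhiteNoise P ξ W)
    (F : Matrix (Fin n) (Fin n) ℝ) (t : ℕ) (u : Fin n → ℝ) :
    ∫ ω, u ⬝ᵥ noiseResponse F ξ t ω ∂P = 0 := by
  induction t generalizing u with
  | zero => simp [noiseResponse]
  | succ t ih =>
    simp only [dotProduct_noiseResponse_succ]
    rw [integral_add ((h.memLp_noiseResponse F t _).integrable one_le_two)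
      ((h.memLp t u).integrable one_le_two), ih, h.mean, add_zero]

/-- The response at time t involves only the noise at times before t, so t = s is allowed; that case
removes the cross terms of the covariance recursion. -/
theorem integral_noiseResponse_mul_noise [IsProbabilityMeasure P] (h : IsWhiteNoise P ξ W)
    (F : Matrix (Fin n) (Fin n) ℝ) (t s : ℕ) (hts : t ≤ s) (u v : Fin n → ℝ) :
    ∫ ω, (u ⬝ᵥ noiseResponse F ξ t ω) * (v ⬝ᵥ ξ s ω) ∂P = 0 := by
  induction t generalizing u with
  | zero => simp [noiseResponse]
  | succ t ih =>
    simp only [dotProduct_noiseResponse_succ, add_mul]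
    refine (integral_add ((h.memLp_noiseResponse F t _).integrable_mul (h.memLp s v))
      ((h.memLp t u).integrable_mul (h.memLp s v))).trans ?_
    simp only [Pi.mul_apply]
    rw [ih (by omega), h.cov_ne t s (by omega), add_zero]

theorem integral_noiseResponse_mul [IsProbabilityMeasure P] (h : IsWhiteNoise P ξ W)
    (F : Matrix (Fin n) (Fin n) ℝ) (t : ℕ) (u v : Fin n → ℝ) :
    ∫ ω, (u ⬝ᵥ noiseResponse F ξ t ω) * (v ⬝ᵥ noiseResponse F ξ t ω) ∂P =
      u ⬝ᵥ stateCov F W t *ᵥ v := by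
  induction t generalizing u v with
  | zero => simp [noiseResponse, stateCov]
  | succ t ih =>
    have e := fun u => h.memLp_noiseResponse F t u
    have x := fun u => h.memLp t u
    have h1 : ∀ ω, (u ⬝ᵥ noiseResponse F ξ (t + 1) ω) * (v ⬝ᵥ noiseResponse F ξ (t + 1) ω) =
        (((Fᵀ *ᵥ u) ⬝ᵥ noiseResponse F ξ t ω) * ((Fᵀ *ᵥ v) ⬝ᵥ noiseResponse F ξ t ω) +
        ((Fᵀ *ᵥ u) ⬝ᵥ noiseResponse F ξ t ω) * (v ⬝ᵥ ξ t ω)) +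
        (((Fᵀ *ᵥ v) ⬝ᵥ noiseResponse F ξ t ω) * (u ⬝ᵥ ξ t ω) +
        (u ⬝ᵥ ξ t ω) * (v ⬝ᵥ ξ t ω)) := fun ω => by
      rw [dotProduct_noiseResponse_succ, dotProduct_noiseResponse_succ]
      ring
    have i1 := (e (Fᵀ *ᵥ u)).integrable_mul (e (Fᵀ *ᵥ v))
    have i2 := (e (Fᵀ *ᵥ u)).integrable_mul (x v)
    have i3 := (e (Fᵀ *ᵥ v)).integrable_mul (x u)
    have i4 := (x u).integrable_mul (x v)
    simp only [h1]
    refine (integral_add (i1.add i2) (i3.add i4)).trans ?_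
    refine (congrArg₂ (· + ·) (integral_add i1 i2) (integral_add i3 i4)).trans ?_
    simp only [Pi.mul_apply]
    rw [ih, h.integral_noiseResponse_mul_noise F t t le_rfl,
      h.integral_noiseResponse_mul_noise F t t le_rfl, h.cov_self, stateCov]
    rw [Matrix.add_mulVec, dotProduct_add, ← Matrix.mulVec_mulVec, ← Matrix.mulVec_mulVec,
      Matrix.dotProduct_mulVec u F, Matrix.mulVec_transpose F u]
    ring

/-- The expectation of a quadratic form in `x + G e_t`. -/
theorem integral_quadratic [IsProbabilityMeasure P] (h : IsWhiteNoise P ξ W)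
    (F : Matrix (Fin n) (Fin n) ℝ) (t : ℕ) {k : ℕ} (M : Matrix (Fin k) (Fin k) ℝ)
    (G : Matrix (Fin k) (Fin n) ℝ) (x : Fin k → ℝ) :
    Integrable (fun ω => (x + G *ᵥ noiseResponse F ξ t ω) ⬝ᵥ
        M *ᵥ (x + G *ᵥ noiseResponse F ξ t ω)) P ∧
      ∫ ω, (x + G *ᵥ noiseResponse F ξ t ω) ⬝ᵥ M *ᵥ (x + G *ᵥ noiseResponse F ξ t ω) ∂P =
        x ⬝ᵥ M *ᵥ x + (M * (G * stateCov F W t * Gᵀ)).trace := by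
  have e := fun u => h.memLp_noiseResponse F t u
  have hi : ∀ i, MemLp (fun ω => (x + G *ᵥ noiseResponse F ξ t ω) i) 2 P := fun i =>
    (memLp_const (x i)).add (e (G.row i))
  have hij : ∀ i j, Integrable (fun ω => (x + G *ᵥ noiseResponse F ξ t ω) i *
      (x + G *ᵥ noiseResponse F ξ t ω) j) P := fun i j => (hi i).integrable_mul (hi j)
  have hval : ∀ i j, ∫ ω, (x + G *ᵥ noiseResponse F ξ t ω) i *
      (x + G *ᵥ noiseResponse F ξ t ω) j ∂P = x i * x j + (G * stateCov F W t * Gᵀ) j i := by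
    intro i j
    have h1 : ∀ ω, (x + G *ᵥ noiseResponse F ξ t ω) i * (x + G *ᵥ noiseResponse F ξ t ω) j =
        (x i * x j + x i * (G.row j ⬝ᵥ noiseResponse F ξ t ω)) +
        (x j * (G.row i ⬝ᵥ noiseResponse F ξ t ω) +
        (G.row j ⬝ᵥ noiseResponse F ξ t ω) * (G.row i ⬝ᵥ noiseResponse F ξ t ω)) := fun ω => by
      have h2 : ∀ l, (G *ᵥ noiseResponse F ξ t ω) l = G.row l ⬝ᵥ noiseResponse F ξ t ω :=
        fun l => rfl
      rw [Pi.add_apply, Pi.add_apply, h2, h2]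
      ring
    simp only [h1]
    have j1 : Integrable (fun _ : Ω => x i * x j) P := integrable_const _
    have j2 := ((e (G.row j)).integrable one_le_two).const_mul (x i)
    have j3 := ((e (G.row i)).integrable one_le_two).const_mul (x j)
    have j4 := (e (G.row j)).integrable_mul (e (G.row i))
    refine (integral_add (j1.add j2) (j3.add j4)).trans ?_
    refine (congrArg₂ (· + ·) (integral_add j1 j2) (integral_add j3 j4)).trans ?_
    simp only [Pi.mul_apply]
    rw [integral_const, integral_const_mul, integral_const_mul, h.integral_noiseResponse,
      h.integral_noiseResponse, h.integral_noiseResponse_mul]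
    simp only [probReal_univ, one_smul, mul_zero, add_zero, zero_add]
    congr 1
    rw [Matrix.mul_apply, Finset.sum_congr rfl fun l _ => by rw [Matrix.mul_apply, Finset.sum_mul],
      Finset.sum_comm, dotProduct_mulVec_eq_sum]
    refine Finset.sum_congr rfl fun a _ => Finset.sum_congr rfl fun b _ => ?_
    rw [Matrix.transpose_apply, Matrix.row_apply, Matrix.row_apply]
    ring
  simp only [dotProduct_mulVec_eq_sum]
  have hM : ∀ i j, Integrable (fun ω => M i j * ((x + G *ᵥ noiseResponse F ξ t ω) i *
      (x + G *ᵥ noiseResponse F ξ t ω) j)) P := fun i j => (hij i j).const_mul _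
  refine ⟨integrable_finsetSum _ fun i _ => integrable_finsetSum _ fun j _ => hM i j, ?_⟩
  refine (integral_finsetSum _ fun i _ => integrable_finsetSum _ fun j _ => hM i j).trans ?_
  rw [Matrix.trace, ← Finset.sum_add_distrib]
  refine Finset.sum_congr rfl fun i _ => ?_
  refine (integral_finsetSum _ fun j _ => hM i j).trans ?_
  rw [Matrix.diag_apply, Matrix.mul_apply, ← Finset.sum_add_distrib]
  refine Finset.sum_congr rfl fun j _ => ?_
  rw [integral_const_mul, hval, mul_add]

end IsWhiteNoise
end WhiteNoise

/-! ### Moments of the closed loop and existence of stationary rates. -/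

namespace RCLQRData

variable {n m : ℕ} {Ω : Type*}

/-- The closed-loop matrix `A - B K`. -/
def closedLoop (D : RCLQRData n m Ω) (X : AffinePolicy n m) : Matrix (Fin n) (Fin n) ℝ :=
  D.A - D.B * X.1

/-- The cost rate of a stationary state with mean `x` and covariance `S`, when the input has
mean `u` and fluctuates with gain `K`. -/
def costRate (D : RCLQRData n m Ω) (K : Matrix (Fin m) (Fin n) ℝ)
    (S : Matrix (Fin n) (Fin n) ℝ) (x : Fin n → ℝ) (u : Fin m → ℝ) : ℝ :=
  x ⬝ᵥ D.Q *ᵥ x + (D.Q * S).trace + (u ⬝ᵥ D.R *ᵥ u + (D.R * (K * S * Kᵀ)).trace)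

variable [MeasurableSpace Ω]

/-- The risk rate of a stationary state with mean `x` and covariance `S`. -/
def riskRate (D : RCLQRData n m Ω) (P : Measure Ω) (S : Matrix (Fin n) (Fin n) ℝ)
    (x : Fin n → ℝ) : ℝ :=
  4 * (x ⬝ᵥ (D.Q * D.W P * D.Q) *ᵥ x + ((D.Q * D.W P * D.Q) * S).trace) +
    4 * (x ⬝ᵥ D.Q *ᵥ D.M₃ P)

/-- The affine drift of the closed-loop state. -/
def drift (D : RCLQRData n m Ω) (P : Measure Ω) (X : AffinePolicy n m) : Fin n → ℝ :=
  D.B *ᵥ X.2 + D.noiseMean P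

/-- The mean of the closed-loop state. -/
def meanState (D : RCLQRData n m Ω) (P : Measure Ω) (X : AffinePolicy n m) : ℕ → Fin n → ℝ :=
  stateMean (D.closedLoop X) (D.drift P X) D.x₀

/-- The covariance of the closed-loop state. -/
def covState (D : RCLQRData n m Ω) (P : Measure Ω) (X : AffinePolicy n m) :
    ℕ → Matrix (Fin n) (Fin n) ℝ :=
  stateCov (D.closedLoop X) (D.W P)

/-- Superposition. The initial state is deterministic, so all randomness sits in the response from
rest, and the covariance recursion starts at 0. -/
theorem state_eq (D : RCLQRData n m Ω) (P : Measure Ω) (X : AffinePolicy n m) (t : ℕ) (ω : Ω) :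
    D.state X t ω = D.meanState P X t +
      noiseResponse (D.closedLoop X) (fun t ω => D.w t ω - D.noiseMean P) t ω := by
  induction t with
  | zero => simp [state, meanState, stateMean, noiseResponse]
  | succ t ih =>
    rw [state, ih]
    simp only [meanState, stateMean, noiseResponse, closedLoop, drift, Matrix.mulVec_add,
      Matrix.sub_mulVec, Matrix.mulVec_neg, ← Matrix.mulVec_mulVec]
    abel

theorem input_eq (D : RCLQRData n m Ω) (P : Measure Ω) (X : AffinePolicy n m) (t : ℕ) (ω : Ω) :
    D.input X t ω = (-(X.1 *ᵥ D.meanState P X t) + X.2) + (-X.1) *ᵥ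
      noiseResponse (D.closedLoop X) (fun t ω => D.w t ω - D.noiseMean P) t ω := by
  rw [input, D.state_eq P, Matrix.mulVec_add, Matrix.neg_mulVec]
  abel

variable {D : RCLQRData n m Ω} {P : Measure Ω} [IsProbabilityMeasure P]

theorem integral_state (hD : IsWhiteNoise P (fun t ω => D.w t ω - D.noiseMean P) (D.W P))
    (X : AffinePolicy n m) (t : ℕ) (M : Matrix (Fin n) (Fin n) ℝ) :
    Integrable (fun ω => D.state X t ω ⬝ᵥ M *ᵥ D.state X t ω) P ∧
      ∫ ω, D.state X t ω ⬝ᵥ M *ᵥ D.state X t ω ∂P =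
        D.meanState P X t ⬝ᵥ M *ᵥ D.meanState P X t + (M * D.covState P X t).trace := by
  have := hD.integral_quadratic (D.closedLoop X) t M 1 (D.meanState P X t)
  simpa only [covState, Matrix.one_mulVec, ← D.state_eq P, Matrix.one_mul, Matrix.transpose_one,
    Matrix.mul_one] using this

theorem integral_input (hD : IsWhiteNoise P (fun t ω => D.w t ω - D.noiseMean P) (D.W P))
    (X : AffinePolicy n m) (t : ℕ) (M : Matrix (Fin m) (Fin m) ℝ) :
    Integrable (fun ω => D.input X t ω ⬝ᵥ M *ᵥ D.input X t ω) P ∧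
      ∫ ω, D.input X t ω ⬝ᵥ M *ᵥ D.input X t ω ∂P =
        (-(X.1 *ᵥ D.meanState P X t) + X.2) ⬝ᵥ M *ᵥ (-(X.1 *ᵥ D.meanState P X t) + X.2) +
          (M * (X.1 * D.covState P X t * X.1ᵀ)).trace := by
  have := hD.integral_quadratic (D.closedLoop X) t M (-X.1)
    (-(X.1 *ᵥ D.meanState P X t) + X.2)
  simpa only [covState, ← D.input_eq P, Matrix.transpose_neg, Matrix.neg_mul, Matrix.mul_neg,
    neg_neg] using this

theorem integral_dotProduct_state
    (hD : IsWhiteNoise P (fun t ω => D.w t ω - D.noiseMean P) (D.W P))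
    (X : AffinePolicy n m) (t : ℕ) (v : Fin n → ℝ) :
    Integrable (fun ω => D.state X t ω ⬝ᵥ v) P ∧
      ∫ ω, D.state X t ω ⬝ᵥ v ∂P = D.meanState P X t ⬝ᵥ v := by
  have h1 := (hD.memLp_noiseResponse (D.closedLoop X) t v).integrable one_le_two
  simp only [dotProduct_comm _ v, D.state_eq P, dotProduct_add]
  refine ⟨(integrable_const _).add h1, ?_⟩
  rw [integral_add (integrable_const _) h1, hD.integral_noiseResponse]
  simp

theorem integrable_stageCost (hD : IsWhiteNoise P (fun t ω => D.w t ω - D.noiseMean P) (D.W P))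
    (X : AffinePolicy n m) (t : ℕ) :
    Integrable (fun ω => D.state X t ω ⬝ᵥ D.Q *ᵥ D.state X t ω +
      D.input X t ω ⬝ᵥ D.R *ᵥ D.input X t ω) P :=
  (integral_state hD X t D.Q).1.add (integral_input hD X t D.R).1

theorem avgCost_eq (hD : IsWhiteNoise P (fun t ω => D.w t ω - D.noiseMean P) (D.W P))
    (X : AffinePolicy n m) (T : ℕ) :
    D.avgCost P X T = (T : ℝ)⁻¹ * ∑ t ∈ Finset.range T, D.costRate X.1 (D.covState P X t)
      (D.meanState P X t) (-(X.1 *ᵥ D.meanState P X t) + X.2) := by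
  rw [avgCost, one_div, integral_finsetSum _ fun t _ => integrable_stageCost hD X t]
  congr 1
  refine Finset.sum_congr rfl fun t _ => ?_
  rw [integral_add (integral_state hD X t D.Q).1 (integral_input hD X t D.R).1,
    (integral_state hD X t D.Q).2, (integral_input hD X t D.R).2, costRate]

theorem avgRisk_eq (hD : IsWhiteNoise P (fun t ω => D.w t ω - D.noiseMean P) (D.W P))
    (X : AffinePolicy n m) (T : ℕ) :
    D.avgRisk P X T = (T : ℝ)⁻¹ * ∑ t ∈ Finset.range T,
      D.riskRate P (D.covState P X t) (D.meanState P X t) := by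
  have h1 := fun t => (integral_state hD X t (D.Q * D.W P * D.Q)).1.const_mul 4
  have h2 := fun t => (integral_dotProduct_state hD X t (D.Q *ᵥ D.M₃ P)).1.const_mul 4
  rw [avgRisk, one_div]
  congr 1
  refine (integral_finsetSum _ fun t _ => (h1 t).add (h2 t)).trans ?_
  refine Finset.sum_congr rfl fun t _ => ?_
  refine (integral_add (h1 t) (h2 t)).trans ?_
  rw [integral_const_mul, integral_const_mul,
    (integral_state hD X t _).2, (integral_dotProduct_state hD X t _).2, riskRate]

/-- A stabilizing policy has a stationary mean `x` and covariance `S`, and its average cost and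
risk are the rates at these. -/
theorem exists_stationary (hD : IsWhiteNoise P (fun t ω => D.w t ω - D.noiseMean P) (D.W P))
    (hW : (D.W P).PosSemidef) {X : AffinePolicy n m} (hX : X ∈ D.stabilizing) :
    ∃ (S : Matrix (Fin n) (Fin n) ℝ) (x : Fin n → ℝ),
      Tendsto (D.covState P X) atTop (𝓝 S) ∧ Tendsto (D.meanState P X) atTop (𝓝 x) ∧
      S.PosSemidef ∧ S = D.closedLoop X * S * (D.closedLoop X)ᵀ + D.W P ∧
      x = D.closedLoop X *ᵥ x + D.drift P X ∧
      Tendsto (D.avgCost P X) atTop (𝓝 (D.costRate X.1 S x (-(X.1 *ᵥ x) + X.2))) ∧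
      Tendsto (D.avgRisk P X) atTop (𝓝 (D.riskRate P S x)) := by
  have hF : IsSchurStable (D.closedLoop X) := hX
  obtain ⟨S, hS⟩ := hF.exists_tendsto_stateCov (D.W P)
  obtain ⟨x, hx⟩ := hF.exists_fixedPoint (D.drift P X)
  have hm : Tendsto (D.meanState P X) atTop (𝓝 x) := hF.tendsto_stateMean hx D.x₀
  refine ⟨S, x, hS, hm, Matrix.PosSemidef.of_tendsto hS (stateCov_posSemidef _ hW),
    eq_of_tendsto_stateCov hS, hx, ?_, ?_⟩
  · have hc : Continuous fun p : Matrix (Fin n) (Fin n) ℝ × (Fin n → ℝ) =>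
        D.costRate X.1 p.1 p.2 (-(X.1 *ᵥ p.2) + X.2) := by
      unfold costRate
      fun_prop
    -- The expected stage costs converge, so their Cesàro means have the same limit.
    have h1 := ((hc.tendsto (S, x)).comp (hS.prodMk_nhds hm)).cesaro
    exact h1.congr fun T => (avgCost_eq hD X T).symm
  · have hc : Continuous fun p : Matrix (Fin n) (Fin n) ℝ × (Fin n → ℝ) =>
        D.riskRate P p.1 p.2 := by
      unfold riskRate
      fun_prop
    have h1 := ((hc.tendsto (S, x)).comp (hS.prodMk_nhds hm)).cesaro
    exact h1.congr fun T => (avgRisk_eq hD X T).symm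

end RCLQRData

/-! ### Observability bounds the state energy by the running cost. -/

section Observability

variable {n m p : ℕ}

theorem IsObservable.eq_zero {A : Matrix (Fin n) (Fin n) ℝ} {C : Matrix (Fin p) (Fin n) ℝ}
    (h : IsObservable A C) {x : Fin n → ℝ} (hx : ∀ k < n, C *ᵥ (A ^ k *ᵥ x) = 0) : x = 0 := by
  set O : Matrix (Fin n × Fin p) (Fin n) ℝ :=
    Matrix.of fun (r : Fin n × Fin p) (j : Fin n) => (C * A ^ (r.1 : ℕ)) r.2 j with hO
  have hrank : O.rank = n := h
  have hinj : Function.Injective O.mulVecLin := by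
    rw [← LinearMap.ker_eq_bot]
    have h1 := O.mulVecLin.finrank_range_add_finrank_ker
    rw [← Matrix.rank, hrank, Module.finrank_fin_fun] at h1
    exact Submodule.finrank_eq_zero.1 (by omega)
  apply hinj
  rw [map_zero, Matrix.mulVecLin_apply]
  ext r
  have h2 := congrFun (hx r.1 r.1.2) r.2
  rw [Matrix.mulVec_mulVec] at h2
  exact h2

/-- The sum is the quadratic form of the observability Gramian. If it vanishes, so does each Q^{1/2}
Aᵏ x with k < n, and observability gives x = 0. -/
theorem exists_gramian_bound {A Q : Matrix (Fin n) (Fin n) ℝ} (hQ : Q.PosSemidef)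
    (h : IsObservable A (psdSqrt Q)) :
    ∃ c : ℝ, 0 < c ∧ ∀ x : Fin n → ℝ,
      x ⬝ᵥ x ≤ c * ∑ k ∈ Finset.range n, (A ^ k *ᵥ x) ⬝ᵥ Q *ᵥ (A ^ k *ᵥ x) := by
  have hG : ∀ x : Fin n → ℝ, x ⬝ᵥ (∑ k ∈ Finset.range n, (A ^ k)ᵀ * Q * A ^ k) *ᵥ x =
      ∑ k ∈ Finset.range n, (A ^ k *ᵥ x) ⬝ᵥ Q *ᵥ (A ^ k *ᵥ x) := fun x => by
    rw [Matrix.sum_mulVec, dotProduct_sum]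
    refine Finset.sum_congr rfl fun k _ => ?_
    rw [← Matrix.mulVec_mulVec, ← Matrix.mulVec_mulVec, Matrix.dotProduct_mulVec x,
      Matrix.vecMul_transpose]
  obtain ⟨c, hc, hle⟩ := Matrix.exists_mul_dotProduct_le_of_pos
    (S := ∑ k ∈ Finset.range n, (A ^ k)ᵀ * Q * A ^ k) fun x hx => by
      rw [hG]
      have hnn : ∀ k ∈ Finset.range n, 0 ≤ (A ^ k *ᵥ x) ⬝ᵥ Q *ᵥ (A ^ k *ᵥ x) :=
        fun k _ => hQ.dotProduct_nonneg _
      refine lt_of_le_of_ne (Finset.sum_nonneg hnn) fun h0 => hx ?_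
      refine h.eq_zero fun k hk => ?_
      have h1 := (Finset.sum_eq_zero_iff_of_nonneg hnn).1 h0.symm k (Finset.mem_range.2 hk)
      rw [← psdSqrt_transpose_mul_self hQ, ← Matrix.mulVec_mulVec, Matrix.dotProduct_mulVec,
        Matrix.vecMul_transpose] at h1
      exact dotProduct_self_eq_zero.1 h1
  refine ⟨c⁻¹, inv_pos.2 hc, fun x => ?_⟩
  rw [le_inv_mul_iff₀ hc, ← hG]
  exact hle x

/-- For an observable pair, the energy of the state of `x_{t+1} = A x_t + B u_t + w_t` is bounded
by the cost and the energy of the disturbance over the next `n` steps. -/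
theorem exists_observability_bound {A Q : Matrix (Fin n) (Fin n) ℝ}
    (B : Matrix (Fin n) (Fin m) ℝ) {R : Matrix (Fin m) (Fin m) ℝ}
    (hQ : Q.PosSemidef) (hR : R.PosDef) (h : IsObservable A (psdSqrt Q)) :
    ∃ c : ℝ, 0 ≤ c ∧ ∀ (x : ℕ → Fin n → ℝ) (u : ℕ → Fin m → ℝ) (w : ℕ → Fin n → ℝ),
      (∀ t, x (t + 1) = A *ᵥ x t + B *ᵥ u t + w t) →
      ∀ T, ∑ t ∈ Finset.range T, x t ⬝ᵥ x t ≤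
        c * ∑ s ∈ Finset.range (T + n), (x s ⬝ᵥ Q *ᵥ x s + u s ⬝ᵥ R *ᵥ u s + w s ⬝ᵥ w s) := by
  obtain ⟨cg, hcg, hgram⟩ := exists_gramian_bound hQ h
  obtain ⟨a, ha, hA⟩ := A.exists_mulVec_dotProduct_le
  obtain ⟨b, hb, hB⟩ := B.exists_mulVec_dotProduct_le
  obtain ⟨q, hq, hQle⟩ := Q.exists_dotProduct_mulVec_le
  obtain ⟨r, hr, hRle⟩ := hR.exists_mul_dotProduct_le
  have hadd : ∀ y z : Fin n → ℝ, (y + z) ⬝ᵥ (y + z) ≤ 2 * (y ⬝ᵥ y) + 2 * (z ⬝ᵥ z) := fun y z => by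
    have := real_dotProduct_self_nonneg (y - z)
    simp only [add_dotProduct, sub_dotProduct, dotProduct_add, dotProduct_sub] at this ⊢
    linarith
  -- the disturbance entering the open-loop system
  have hv : ∃ e : ℝ, 0 < e ∧ ∀ (u : Fin m → ℝ) (w : Fin n → ℝ),
      (B *ᵥ u + w) ⬝ᵥ (B *ᵥ u + w) ≤ e * (u ⬝ᵥ R *ᵥ u + w ⬝ᵥ w) := by
    refine ⟨2 * b / r + 2, by positivity, fun u w => ?_⟩
    have h1 : u ⬝ᵥ u ≤ (u ⬝ᵥ R *ᵥ u) / r := by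
      rw [le_div_iff₀ hr, mul_comm]
      exact hRle u
    have h2 := hR.posSemidef.dotProduct_nonneg u
    have h3 := real_dotProduct_self_nonneg w
    have h4 : 0 ≤ 2 * b / r * (w ⬝ᵥ w) := by positivity
    have h5 : 2 * (b * (u ⬝ᵥ u)) ≤ 2 * b / r * (u ⬝ᵥ R *ᵥ u) := by
      calc 2 * (b * (u ⬝ᵥ u)) ≤ 2 * (b * ((u ⬝ᵥ R *ᵥ u) / r)) := by gcongr
        _ = _ := by ring
    linarith [hadd (B *ᵥ u) w, hB u]
  obtain ⟨e, he, hv⟩ := hv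
  -- the deviation from the free motion
  have hdev : ∀ k : ℕ, ∃ d : ℝ, 0 < d ∧ ∀ (x : ℕ → Fin n → ℝ) (v : ℕ → Fin n → ℝ),
      (∀ t, x (t + 1) = A *ᵥ x t + v t) → ∀ t,
      (x (t + k) - A ^ k *ᵥ x t) ⬝ᵥ (x (t + k) - A ^ k *ᵥ x t) ≤
        d * ∑ i ∈ Finset.range k, v (t + i) ⬝ᵥ v (t + i) := by
    intro k
    induction k with
    | zero => exact ⟨1, one_pos, fun x v _ t => by simp⟩
    | succ k ih =>
      obtain ⟨d, hd, ih⟩ := ih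
      refine ⟨2 * (a * d) + 2, by positivity, fun x v hx t => ?_⟩
      have h1 : x (t + (k + 1)) - A ^ (k + 1) *ᵥ x t =
          A *ᵥ (x (t + k) - A ^ k *ᵥ x t) + v (t + k) := by
        rw [← add_assoc, hx, pow_succ', ← Matrix.mulVec_mulVec, Matrix.mulVec_sub]
        abel
      have h2 := hadd (A *ᵥ (x (t + k) - A ^ k *ᵥ x t)) (v (t + k))
      have h3 := hA (x (t + k) - A ^ k *ᵥ x t)
      have h4 := mul_le_mul_of_nonneg_left (ih x v hx t) ha.le
      have h5 : 0 ≤ ∑ i ∈ Finset.range k, v (t + i) ⬝ᵥ v (t + i) :=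
        Finset.sum_nonneg fun i _ => real_dotProduct_self_nonneg _
      have h6 := mul_nonneg (mul_nonneg ha.le hd.le) (real_dotProduct_self_nonneg (v (t + k)))
      rw [h1, Finset.sum_range_succ]
      linarith
  choose d hd hdev using hdev
  -- In the sum of all windows of length n, each time occurs at most n times; n + 1 is a convenient
  -- upper bound for this count.
  refine ⟨cg * (∑ k ∈ Finset.range n, (2 + 2 * q * d k * e)) * (n + 1), ?_,
    fun x u w hx T => ?_⟩
  · have hk : ∀ k, 0 ≤ 2 + 2 * q * d k * e := fun k => by
      have := hd k
      positivity
    have := Finset.sum_nonneg fun k (_ : k ∈ Finset.range n) => hk k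
    positivity
  set g : ℕ → ℝ := fun s => x s ⬝ᵥ Q *ᵥ x s + u s ⬝ᵥ R *ᵥ u s + w s ⬝ᵥ w s with hg
  have hg1 : ∀ s, x s ⬝ᵥ Q *ᵥ x s ≤ g s := fun s => by
    linarith [hR.posSemidef.dotProduct_nonneg (u s), real_dotProduct_self_nonneg (w s)]
  have hg2 : ∀ s, u s ⬝ᵥ R *ᵥ u s + w s ⬝ᵥ w s ≤ g s := fun s => by
    linarith [hQ.dotProduct_nonneg (x s)]
  have hg0 : ∀ s, 0 ≤ g s := fun s => (hQ.dotProduct_nonneg (x s)).trans (hg1 s)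
  have hx' : ∀ t, x (t + 1) = A *ᵥ x t + (B *ᵥ u t + w t) := fun t => by
    rw [hx, add_assoc]
  -- The free motion is the actual state minus the deviation: the cost controls the former, the
  -- input and disturbance energies the latter.
  have hstep : ∀ t k, k < n → (A ^ k *ᵥ x t) ⬝ᵥ Q *ᵥ (A ^ k *ᵥ x t) ≤
      (2 + 2 * q * d k * e) * ∑ i ∈ Finset.range n, g (t + i) := by
    intro t k hk
    have h1 := hQ.dotProduct_sub_le (x (t + k)) (x (t + k) - A ^ k *ᵥ x t)
    rw [sub_sub_cancel] at h1
    have h2 := hQle (x (t + k) - A ^ k *ᵥ x t)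
    have h3 := hdev k x (fun t => B *ᵥ u t + w t) hx' t
    have h4 : ∑ i ∈ Finset.range k, (B *ᵥ u (t + i) + w (t + i)) ⬝ᵥ
        (B *ᵥ u (t + i) + w (t + i)) ≤ e * ∑ i ∈ Finset.range n, g (t + i) := by
      rw [Finset.mul_sum]
      refine (Finset.sum_le_sum fun i _ => (hv _ _).trans
        (mul_le_mul_of_nonneg_left (hg2 (t + i)) he.le)).trans ?_
      exact Finset.sum_le_sum_of_subset_of_nonneg (Finset.range_mono hk.le)
        fun i _ _ => mul_nonneg he.le (hg0 _)
    have h5 : g (t + k) ≤ ∑ i ∈ Finset.range n, g (t + i) :=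
      Finset.single_le_sum (f := fun i => g (t + i)) (fun i _ => hg0 _) (Finset.mem_range.2 hk)
    have h6 := mul_le_mul_of_nonneg_left (h3.trans (mul_le_mul_of_nonneg_left h4 (hd k).le)) hq.le
    have h7 := hg1 (t + k)
    linarith
  have hsum : ∀ t, x t ⬝ᵥ x t ≤ cg * (∑ k ∈ Finset.range n, (2 + 2 * q * d k * e)) *
      ∑ i ∈ Finset.range n, g (t + i) := fun t => by
    refine (hgram (x t)).trans ?_
    rw [mul_assoc, Finset.sum_mul]
    exact mul_le_mul_of_nonneg_left
      (Finset.sum_le_sum fun k hk => hstep t k (Finset.mem_range.1 hk)) hcg.le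
  refine (Finset.sum_le_sum fun t _ => hsum t).trans ?_
  rw [← Finset.mul_sum, Finset.sum_comm, mul_assoc _ ((n : ℝ) + 1)]
  refine mul_le_mul_of_nonneg_left ?_ ?_
  · calc ∑ i ∈ Finset.range n, ∑ t ∈ Finset.range T, g (t + i)
        ≤ ∑ _i ∈ Finset.range n, ∑ s ∈ Finset.range (T + n), g s := by
          refine Finset.sum_le_sum fun i hi => ?_
          have h1 : ∑ t ∈ Finset.range T, g (t + i) =
              ∑ s ∈ (Finset.range T).map (addRightEmbedding i), g s := by
            simp [Finset.sum_map]
          rw [h1]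
          refine Finset.sum_le_sum_of_subset_of_nonneg (fun s hs => ?_) fun s _ _ => hg0 s
          simp only [Finset.mem_map, Finset.mem_range, addRightEmbedding_apply] at hs hi ⊢
          obtain ⟨t, ht, rfl⟩ := hs
          omega
      _ = n * ∑ s ∈ Finset.range (T + n), g s := by simp
      _ ≤ _ := by
        have := Finset.sum_nonneg fun s (_ : s ∈ Finset.range (T + n)) => hg0 s
        linarith
  · refine mul_nonneg hcg.le (Finset.sum_nonneg fun k _ => ?_)
    have := hd k
    positivity

end Observability

/-! ### Finite cost implies stability; stationary moments and their relaxation. -/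

namespace RCLQRData

variable {n m : ℕ} {Ω : Type*} {D : RCLQRData n m Ω}

theorem costRate_nonneg (hQ : D.Q.PosSemidef) (hR : D.R.PosDef)
    (K : Matrix (Fin m) (Fin n) ℝ) {S : Matrix (Fin n) (Fin n) ℝ} (hS : S.PosSemidef)
    (x : Fin n → ℝ) (u : Fin m → ℝ) : 0 ≤ D.costRate K S x u :=
  add_nonneg (add_nonneg (hQ.dotProduct_nonneg x) (hQ.trace_mul_nonneg hS))
    (add_nonneg (hR.posSemidef.dotProduct_nonneg u)
      (hR.posSemidef.trace_mul_nonneg (hS.mul_mul_transpose K)))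

variable [MeasurableSpace Ω] {P : Measure Ω}

theorem integral_noise_sq [IsProbabilityMeasure P]
    (hD : IsWhiteNoise P (fun t ω => D.w t ω - D.noiseMean P) (D.W P)) (t : ℕ) :
    Integrable (fun ω => D.w t ω ⬝ᵥ D.w t ω) P ∧
      ∫ ω, D.w t ω ⬝ᵥ D.w t ω ∂P = D.noiseMean P ⬝ᵥ D.noiseMean P + (D.W P).trace := by
  -- With F = 0 the response at time t + 1 is the centered noise at time t.
  have := hD.integral_quadratic 0 (t + 1) 1 1 (D.noiseMean P)
  simpa [noiseResponse, stateCov] using this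

theorem avgCost_nonneg [IsProbabilityMeasure P]
    (hD : IsWhiteNoise P (fun t ω => D.w t ω - D.noiseMean P) (D.W P))
    (hW : (D.W P).PosSemidef) (hQ : D.Q.PosSemidef) (hR : D.R.PosDef) (X : AffinePolicy n m)
    (T : ℕ) : 0 ≤ D.avgCost P X T := by
  rw [avgCost_eq hD]
  exact mul_nonneg (by positivity)
    (Finset.sum_nonneg fun t _ => costRate_nonneg hQ hR _ (stateCov_posSemidef _ hW t) _ _)

/-- The energy of the state is bounded by the average cost. -/
theorem exists_energy_bound [IsProbabilityMeasure P]
    (hD : IsWhiteNoise P (fun t ω => D.w t ω - D.noiseMean P) (D.W P))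
    (hQ : D.Q.PosSemidef) (hR : D.R.PosDef) (hAQ : IsObservable D.A (psdSqrt D.Q)) :
    ∃ c : ℝ, 0 ≤ c ∧ ∀ (X : AffinePolicy n m) (T : ℕ),
      ∑ t ∈ Finset.range T,
        (D.meanState P X t ⬝ᵥ D.meanState P X t + (D.covState P X t).trace) ≤
      c * ((T + n : ℕ) * (D.avgCost P X (T + n) +
        (D.noiseMean P ⬝ᵥ D.noiseMean P + (D.W P).trace))) := by
  obtain ⟨c, hc, h⟩ := exists_observability_bound D.B hQ hR hAQ
  refine ⟨c, hc, fun X T => ?_⟩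
  have h1 : ∀ t, Integrable (fun ω => D.state X t ω ⬝ᵥ D.state X t ω) P ∧
      ∫ ω, D.state X t ω ⬝ᵥ D.state X t ω ∂P =
        D.meanState P X t ⬝ᵥ D.meanState P X t + (D.covState P X t).trace := fun t => by
    simpa using integral_state hD X t 1
  have h2 := fun t => integrable_stageCost hD X t
  have h3 := fun t => (integral_noise_sq hD t).1
  have hle : ∫ ω, ∑ t ∈ Finset.range T, D.state X t ω ⬝ᵥ D.state X t ω ∂P ≤
      ∫ ω, c * ∑ s ∈ Finset.range (T + n), ((D.state X s ω ⬝ᵥ D.Q *ᵥ D.state X s ω +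
        D.input X s ω ⬝ᵥ D.R *ᵥ D.input X s ω) + D.w s ω ⬝ᵥ D.w s ω) ∂P := by
    refine integral_mono (integrable_finsetSum _ fun t _ => (h1 t).1)
      ((integrable_finsetSum _ fun t _ => (h2 t).add (h3 t)).const_mul c) fun ω => ?_
    exact h (fun t => D.state X t ω) (fun t => D.input X t ω) (fun t => D.w t ω)
      (fun t => rfl) T
  rw [integral_finsetSum _ fun t _ => (h1 t).1, Finset.sum_congr rfl fun t _ => (h1 t).2,
    integral_const_mul] at hle
  refine hle.trans_eq ?_
  congr 1
  refine (integral_finsetSum _ fun t _ => (h2 t).add (h3 t)).trans ?_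
  refine (Finset.sum_congr rfl fun t _ => integral_add (h2 t) (h3 t)).trans ?_
  rw [Finset.sum_add_distrib, Finset.sum_congr rfl fun t _ => (integral_noise_sq hD t).2,
    ← integral_finsetSum _ fun t _ => h2 t, Finset.sum_const, Finset.card_range, nsmul_eq_mul,
    avgCost, mul_add _ (1 / ((T + n : ℕ) : ℝ) * _)]
  congr 1
  rcases Nat.eq_zero_or_pos (T + n) with h0 | h0
  · simp [h0]
  · have : ((T + n : ℕ) : ℝ) ≠ 0 := by exact_mod_cast h0.ne'
    rw [← mul_assoc, mul_one_div_cancel this, one_mul]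

/-- A policy of finite long-run average cost is stabilizing. -/
theorem mem_stabilizing_of_J_lt_top [IsProbabilityMeasure P]
    (hD : IsWhiteNoise P (fun t ω => D.w t ω - D.noiseMean P) (D.W P))
    (hW : (D.W P).PosDef) (hQ : D.Q.PosSemidef) (hR : D.R.PosDef)
    (hAQ : IsObservable D.A (psdSqrt D.Q)) {X : AffinePolicy n m} (hX : D.J P X < ⊤) :
    X ∈ D.stabilizing := by
  obtain ⟨c, hc, hE⟩ := exists_energy_bound hD hQ hR hAQ
  obtain ⟨C, hC, -⟩ := EReal.lt_iff_exists_real_btwn.1 hX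
  have hev : ∀ᶠ T in atTop, D.avgCost P X T < C := by
    filter_upwards [eventually_lt_of_limsup_lt hC] with T hT
    exact_mod_cast hT
  obtain ⟨N₀, hN₀⟩ := eventually_atTop.1 hev
  set σ := D.noiseMean P ⬝ᵥ D.noiseMean P + (D.W P).trace with hσ
  have hmono := trace_stateCov_mono (D.closedLoop X) hW.posSemidef
  have hnn : ∀ t, 0 ≤ (D.covState P X t).trace := fun t =>
    (stateCov_posSemidef _ hW.posSemidef t).trace_nonneg
  have hσ0 : 0 ≤ σ := add_nonneg (real_dotProduct_self_nonneg _) hW.posSemidef.trace_nonneg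
  have hC0 : 0 ≤ C := (avgCost_nonneg hD hW.posSemidef hQ hR X N₀).trans (hN₀ N₀ le_rfl).le
  refine isSchurStable_of_trace_stateCov_le hW (C := 3 * (c * (C + σ))) fun t => ?_
  -- The covariance trace is monotone, so the second half of a horizon 2N has energy at least N
  -- times the trace at N, while the cost bound is linear in N. Since n ≤ N, the horizon 2N + n is
  -- at most 3N, whence the 3.
  set N := t + N₀ + n + 1 with hN
  refine (hmono (by omega : t ≤ N)).trans ?_
  have h1 := hE X (N + N)
  have h2 := (hN₀ (N + N + n) (by omega)).le
  have h3 : N * (D.covState P X N).trace ≤ ∑ t ∈ Finset.range (N + N),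
      (D.meanState P X t ⬝ᵥ D.meanState P X t + (D.covState P X t).trace) := by
    rw [Finset.sum_range_add]
    have h4 : 0 ≤ ∑ t ∈ Finset.range N,
        (D.meanState P X t ⬝ᵥ D.meanState P X t + (D.covState P X t).trace) :=
      Finset.sum_nonneg fun t _ => add_nonneg (real_dotProduct_self_nonneg _) (hnn t)
    have h5 : N * (D.covState P X N).trace ≤ ∑ t ∈ Finset.range N,
        (D.meanState P X (N + t) ⬝ᵥ D.meanState P X (N + t) + (D.covState P X (N + t)).trace) := by
      calc N * (D.covState P X N).trace = ∑ _t ∈ Finset.range N, (D.covState P X N).trace := by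
            simp
        _ ≤ _ := Finset.sum_le_sum fun t _ =>
            (hmono (by omega : N ≤ N + t)).trans
              (le_add_of_nonneg_left (real_dotProduct_self_nonneg _))
    linarith
  have hNpos : (0 : ℝ) < N := by exact_mod_cast (by omega : 0 < N)
  have h6 : ((N + N + n : ℕ) : ℝ) ≤ 3 * N := by exact_mod_cast (by omega : N + N + n ≤ 3 * N)
  have h7 : N * (D.covState P X N).trace ≤ N * (3 * (c * (C + σ))) := by
    refine (h3.trans h1).trans ?_
    calc c * (((N + N + n : ℕ) : ℝ) * (D.avgCost P X (N + N + n) + σ))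
        ≤ c * ((3 * N) * (C + σ)) := by
          refine mul_le_mul_of_nonneg_left ?_ hc
          refine mul_le_mul h6 (by linarith) ?_ (by positivity)
          exact add_nonneg (avgCost_nonneg hD hW.posSemidef hQ hR X _) hσ0
      _ = _ := by ring
  exact le_of_mul_le_mul_left h7 hNpos

/-- The limit of the average cost. -/
def costLim (D : RCLQRData n m Ω) (P : Measure Ω) (X : AffinePolicy n m) : ℝ :=
  limUnder atTop (D.avgCost P X)

/-- The limit of the average risk. -/
def riskLim (D : RCLQRData n m Ω) (P : Measure Ω) (X : AffinePolicy n m) : ℝ :=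
  limUnder atTop (D.avgRisk P X)

/-- Stationary moments `(S, x, u)` of a policy with gain `K`. -/
structure IsStationary (D : RCLQRData n m Ω) (P : Measure Ω) (K : Matrix (Fin m) (Fin n) ℝ)
    (S : Matrix (Fin n) (Fin n) ℝ) (x : Fin n → ℝ) (u : Fin m → ℝ) : Prop where
  posSemidef : S.PosSemidef
  cov_eq : S = (D.A - D.B * K) * S * (D.A - D.B * K)ᵀ + D.W P
  mean_eq : x = D.A *ᵥ x + D.B *ᵥ u + D.noiseMean P

section

variable [IsProbabilityMeasure P]
  (hD : IsWhiteNoise P (fun t ω => D.w t ω - D.noiseMean P) (D.W P))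
include hD

theorem tendsto_avgCost (hW : (D.W P).PosSemidef) {X : AffinePolicy n m}
    (hX : X ∈ D.stabilizing) : Tendsto (D.avgCost P X) atTop (𝓝 (D.costLim P X)) := by
  obtain ⟨S, x, -, -, -, -, -, h, -⟩ := exists_stationary hD hW hX
  exact tendsto_nhds_limUnder ⟨_, h⟩

theorem tendsto_avgRisk (hW : (D.W P).PosSemidef) {X : AffinePolicy n m}
    (hX : X ∈ D.stabilizing) : Tendsto (D.avgRisk P X) atTop (𝓝 (D.riskLim P X)) := by
  obtain ⟨S, x, -, -, -, -, -, -, h⟩ := exists_stationary hD hW hX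
  exact tendsto_nhds_limUnder ⟨_, h⟩

theorem J_eq (hW : (D.W P).PosSemidef) {X : AffinePolicy n m} (hX : X ∈ D.stabilizing) :
    D.J P X = (D.costLim P X : EReal) :=
  ((continuous_coe_real_ereal.tendsto _).comp (tendsto_avgCost hD hW hX)).limsup_eq

theorem Jc_eq (hW : (D.W P).PosSemidef) {X : AffinePolicy n m} (hX : X ∈ D.stabilizing) :
    D.Jc P X = (D.riskLim P X : EReal) :=
  ((continuous_coe_real_ereal.tendsto _).comp (tendsto_avgRisk hD hW hX)).limsup_eq

/-- The long-run rates of a stabilizing policy are those of its stationary moments, which are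
bounded in terms of the cost. -/
theorem exists_isStationary (hW : (D.W P).PosSemidef) (hQ : D.Q.PosSemidef) (hR : D.R.PosDef)
    (hAQ : IsObservable D.A (psdSqrt D.Q)) :
    ∃ c : ℝ, ∀ X ∈ D.stabilizing, ∃ S x u, D.IsStationary P X.1 S x u ∧
      D.costLim P X = D.costRate X.1 S x u ∧ D.riskLim P X = D.riskRate P S x ∧
      x ⬝ᵥ x + S.trace ≤
        c * (D.costLim P X + (D.noiseMean P ⬝ᵥ D.noiseMean P + (D.W P).trace)) := by
  obtain ⟨c, hc, hE⟩ := exists_energy_bound hD hQ hR hAQ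
  refine ⟨c, fun X hX => ?_⟩
  obtain ⟨S, x, hS, hx, hpsd, hSeq, hxeq, hcost, hrisk⟩ := exists_stationary hD hW hX
  refine ⟨S, x, -(X.1 *ᵥ x) + X.2, ⟨hpsd, hSeq, ?_⟩, hcost.limUnder_eq, hrisk.limUnder_eq, ?_⟩
  · conv_lhs => rw [hxeq]
    simp only [closedLoop, drift, Matrix.sub_mulVec, Matrix.mulVec_add, Matrix.mulVec_neg,
      ← Matrix.mulVec_mulVec]
    abel
  · set σ := D.noiseMean P ⬝ᵥ D.noiseMean P + (D.W P).trace
    have hcont : Continuous fun p : Matrix (Fin n) (Fin n) ℝ × (Fin n → ℝ) =>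
        p.2 ⬝ᵥ p.2 + p.1.trace := by fun_prop
    have h1 := ((hcont.tendsto (S, x)).comp (hS.prodMk_nhds hx)).cesaro
    -- This is the energy bound divided by T: the n extra steps contribute (T + n)/T, which tends to
    -- 1.
    have h2 : Tendsto (fun T : ℕ => c * ((1 + n * (T : ℝ)⁻¹) * (D.avgCost P X (T + n) + σ)))
        atTop (𝓝 (c * ((1 + n * 0) * (D.costLim P X + σ)))) := by
      refine Tendsto.const_mul _ (Tendsto.mul ?_ ?_)
      · exact (tendsto_inv_atTop_nhds_zero_nat.const_mul _).const_add _
      · exact ((tendsto_add_atTop_iff_nat n).2 (tendsto_avgCost hD hW hX)).add_const _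
    have h3 := le_of_tendsto_of_tendsto h1 h2 ?_
    · simpa using h3
    · filter_upwards [eventually_gt_atTop 0] with T hT
      have hT' : (0 : ℝ) < T := by exact_mod_cast hT
      rw [inv_mul_le_iff₀ hT']
      refine (hE X T).trans_eq ?_
      push_cast
      field_simp

/-- Relaxed stationary moments are realized by a stabilizing policy of no larger rates. -/
theorem exists_stabilizing_le (hW : (D.W P).PosDef) (hQ : D.Q.PosSemidef) (hR : D.R.PosDef)
    {K : Matrix (Fin m) (Fin n) ℝ} {S : Matrix (Fin n) (Fin n) ℝ} {x : Fin n → ℝ}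
    {u : Fin m → ℝ} (hS : S.PosSemidef)
    (hcov : (S - (D.A - D.B * K) * S * (D.A - D.B * K)ᵀ - D.W P).PosSemidef)
    (hmean : x = D.A *ᵥ x + D.B *ᵥ u + D.noiseMean P) :
    ∃ X ∈ D.stabilizing, D.costLim P X ≤ D.costRate K S x u ∧
      D.riskLim P X ≤ D.riskRate P S x := by
  have hF : IsSchurStable (D.A - D.B * K) := isSchurStable_of_posSemidef hW hS hcov
  -- This offset makes the input equal to u at the mean state x, so x is the fixed point of the
  -- closed-loop mean.
  let X : AffinePolicy n m := (K, K *ᵥ x + u)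
  have hX : X ∈ D.stabilizing := hF
  refine ⟨X, hX, ?_⟩
  obtain ⟨S', x', hS', hx', -, -, -, hcost, hrisk⟩ := exists_stationary hD hW.posSemidef hX
  have hfix : x = D.closedLoop X *ᵥ x + D.drift P X := by
    conv_lhs => rw [hmean]
    simp only [closedLoop, drift, X, Matrix.sub_mulVec, Matrix.mulVec_add, ← Matrix.mulVec_mulVec]
    abel
  obtain rfl : x' = x := tendsto_nhds_unique hx' (hF.tendsto_stateMean hfix D.x₀)
  -- The supersolution S dominates every finite-time covariance, hence the limit S'. The means
  -- agree, so only the trace terms differ.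
  have hSS' : (S - S').PosSemidef := Matrix.PosSemidef.of_tendsto (hS'.const_sub S) fun t =>
    posSemidef_sub_stateCov hS hcov t
  have hu : -(X.1 *ᵥ x') + X.2 = u := by simp [X]
  rw [costLim, riskLim, hcost.limUnder_eq, hrisk.limUnder_eq, hu]
  have h1 := hQ.trace_mul_nonneg hSS'
  have h2 := hR.posSemidef.trace_mul_nonneg (hSS'.mul_mul_transpose K)
  have hQWQ : (D.Q * D.W P * D.Q).PosSemidef := by
    have := hW.posSemidef.mul_mul_transpose D.Q
    rwa [show D.Qᵀ = D.Q from hQ.isHermitian] at this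
  have h3 := hQWQ.trace_mul_nonneg hSS'
  simp only [Matrix.mul_sub, Matrix.sub_mul, Matrix.trace_sub] at h1 h2 h3
  constructor
  · simp only [costRate, X]
    linarith
  · simp only [riskRate]
    linarith

end

end RCLQRData

/-! ### Matrix convexity and entrywise bounds. -/

section MatrixConvexity

variable {n k : ℕ}

/-- Joint convexity of `(M S, S) ↦ M S Mᵀ`. -/
theorem posSemidef_mul_mul_transpose_convex {a b : ℝ} (ha : 0 ≤ a) (hb : 0 ≤ b)
    {S₁ S₂ : Matrix (Fin n) (Fin n) ℝ} (h₁ : S₁.PosSemidef) (h₂ : S₂.PosSemidef)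
    {M₁ M₂ M : Matrix (Fin k) (Fin n) ℝ}
    (hM : M * (a • S₁ + b • S₂) = a • (M₁ * S₁) + b • (M₂ * S₂)) :
    (a • (M₁ * S₁ * M₁ᵀ) + b • (M₂ * S₂ * M₂ᵀ) - M * (a • S₁ + b • S₂) * Mᵀ).PosSemidef := by
  -- The gap is exactly the weighted sum of (Mᵢ - M) Sᵢ (Mᵢ - M)ᵀ: by `hM`, each of the two cross
  -- terms equals -M S Mᵀ with S the combined matrix.
  have hpos := ((h₁.mul_mul_transpose (M₁ - M)).smul ha).add
    ((h₂.mul_mul_transpose (M₂ - M)).smul hb)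
  convert hpos using 1
  have hMt := congrArg Matrix.transpose hM
  have e₁ : S₁ᵀ = S₁ := h₁.isHermitian
  have e₂ : S₂ᵀ = S₂ := h₂.isHermitian
  simp only [Matrix.transpose_mul, Matrix.transpose_add, Matrix.transpose_smul, e₁, e₂] at hMt
  have h3 := congrArg (M * ·) hMt
  have h4 := congrArg (· * Mᵀ) hM
  simp only [Matrix.mul_add, Matrix.add_mul, Matrix.mul_smul, Matrix.smul_mul, Matrix.mul_sub,
    Matrix.sub_mul, Matrix.transpose_sub, smul_sub, ← Matrix.mul_assoc] at h3 h4 ⊢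
  have h5 : a • (M * S₁ * M₁ᵀ) + b • (M * S₂ * M₂ᵀ) =
      a • (M * S₁ * Mᵀ) + b • (M * S₂ * Mᵀ) := h3.symm
  linear_combination (norm := module) h5 - h4

/-- Testing the form on eᵢ ± eⱼ gives 2|Sᵢⱼ| ≤ Sᵢᵢ + Sⱼⱼ. -/
theorem Matrix.PosSemidef.abs_apply_le_trace {S : Matrix (Fin n) (Fin n) ℝ} (hS : S.PosSemidef)
    (i j : Fin n) : |S i j| ≤ S.trace := by
  have hd : ∀ i, S i i ≤ S.trace := fun i =>
    Finset.single_le_sum (f := fun i => S i i) (fun i _ => hS.diag_nonneg) (Finset.mem_univ i)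
  have hsym : S j i = S i j := by
    have := hS.isHermitian.apply i j
    simpa using this
  have h1 := hS.dotProduct_nonneg (Pi.single i 1 + Pi.single j 1)
  have h2 := hS.dotProduct_nonneg (Pi.single i 1 - Pi.single j 1)
  simp [Matrix.mulVec_add, Matrix.mulVec_sub, hsym] at h1 h2
  rw [abs_le]
  constructor <;> linarith [hd i, hd j]

theorem Matrix.PosDef.exists_mul_trace_le {R : Matrix (Fin k) (Fin k) ℝ} (hR : R.PosDef) :
    ∃ r : ℝ, 0 < r ∧ ∀ S : Matrix (Fin k) (Fin k) ℝ, S.PosSemidef →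
      r * S.trace ≤ (R * S).trace := by
  obtain ⟨r, hr, h⟩ := hR.exists_mul_dotProduct_le
  refine ⟨r, hr, fun S hS => ?_⟩
  have hd : (R - r • (1 : Matrix (Fin k) (Fin k) ℝ)).PosSemidef := by
    refine Matrix.PosSemidef.of_dotProduct_mulVec_nonneg ?_ fun x => ?_
    · refine hR.isHermitian.sub ?_
      simp [Matrix.IsHermitian]
    · have := h x
      simp only [star_trivial, Matrix.sub_mulVec, Matrix.smul_mulVec, Matrix.one_mulVec,
        dotProduct_sub, dotProduct_smul, smul_eq_mul]
      linarith
  have := hd.trace_mul_nonneg hS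
  simp only [Matrix.sub_mul, Matrix.smul_mul, Matrix.one_mul, Matrix.trace_sub,
    Matrix.trace_smul, smul_eq_mul] at this
  linarith

theorem abs_apply_le_of_dotProduct_self_le {x : Fin n → ℝ} {c : ℝ} (h : x ⬝ᵥ x ≤ c)
    (i : Fin n) : |x i| ≤ c + 1 := by
  have h1 : x i * x i ≤ x ⬝ᵥ x :=
    Finset.single_le_sum (f := fun i => x i * x i) (fun i _ => mul_self_nonneg _)
      (Finset.mem_univ i)
  rw [abs_le]
  constructor <;> nlinarith [sq_nonneg (x i - 1), sq_nonneg (x i + 1)]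

end MatrixConvexity

/-! ### Convexity, lower bound and compactness for the pair (cost, risk). -/

namespace RCLQRData

variable {n m : ℕ} {Ω : Type*} [MeasurableSpace Ω] {D : RCLQRData n m Ω} {P : Measure Ω}
  [IsProbabilityMeasure P]

/-- The pairs of long-run cost and risk of stabilizing policies are convex up to domination. -/
theorem exists_stabilizing_convex
    (hD : IsWhiteNoise P (fun t ω => D.w t ω - D.noiseMean P) (D.W P))
    (hW : (D.W P).PosDef) (hQ : D.Q.PosSemidef) (hR : D.R.PosDef)
    (hAQ : IsObservable D.A (psdSqrt D.Q)) {X₁ X₂ : AffinePolicy n m}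
    (h₁ : X₁ ∈ D.stabilizing) (h₂ : X₂ ∈ D.stabilizing) {a b : ℝ} (ha : 0 ≤ a) (hb : 0 ≤ b)
    (hab : a + b = 1) :
    ∃ X ∈ D.stabilizing, D.costLim P X ≤ a * D.costLim P X₁ + b * D.costLim P X₂ ∧
      D.riskLim P X ≤ a * D.riskLim P X₁ + b * D.riskLim P X₂ := by
  obtain ⟨c, hc⟩ := exists_isStationary hD hW.posSemidef hQ hR hAQ
  obtain ⟨S₁, x₁, u₁, hs₁, hj₁, hr₁, -⟩ := hc X₁ h₁
  obtain ⟨S₂, x₂, u₂, hs₂, hj₂, hr₂, -⟩ := hc X₂ h₂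
  set S := a • S₁ + b • S₂ with hS
  have e : S = D.W P + (a • ((D.A - D.B * X₁.1) * S₁ * (D.A - D.B * X₁.1)ᵀ) +
      b • ((D.A - D.B * X₂.1) * S₂ * (D.A - D.B * X₂.1)ᵀ)) := by
    rw [hS]
    conv_lhs => rw [hs₁.cov_eq, hs₂.cov_eq]
    obtain rfl : b = 1 - a := by linarith
    module
  have hSdef : S.PosDef := by
    rw [e]
    exact hW.add_posSemidef (((hs₁.posSemidef.mul_mul_transpose _).smul ha).add
      ((hs₂.posSemidef.mul_mul_transpose _).smul hb))
  have hSpsd := hSdef.posSemidef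
  have hdet : IsUnit S.det := (Matrix.isUnit_iff_isUnit_det S).1 hSdef.isUnit
  -- The product KS, not K, is what gets averaged. Division by S is possible because both
  -- covariances dominate W ≻ 0.
  set K := (a • (X₁.1 * S₁) + b • (X₂.1 * S₂)) * S⁻¹ with hK
  have hKS : K * S = a • (X₁.1 * S₁) + b • (X₂.1 * S₂) := by
    rw [hK, Matrix.mul_assoc, Matrix.nonsing_inv_mul _ hdet, Matrix.mul_one]
  have hFS : (D.A - D.B * K) * S =
      a • ((D.A - D.B * X₁.1) * S₁) + b • ((D.A - D.B * X₂.1) * S₂) := by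
    rw [Matrix.sub_mul, Matrix.mul_assoc, hKS, hS]
    simp only [Matrix.mul_add, Matrix.mul_smul, Matrix.sub_mul, Matrix.mul_assoc]
    module
  -- Averaging turns the two Lyapunov equations into an inequality, which is all that the relaxation
  -- needs.
  have hcov : (S - (D.A - D.B * K) * S * (D.A - D.B * K)ᵀ - D.W P).PosSemidef := by
    have := posSemidef_mul_mul_transpose_convex ha hb hs₁.posSemidef hs₂.posSemidef hFS
    convert this using 1
    rw [← hS]
    conv_lhs => enter [1, 1]; rw [e]
    abel
  have hmean : a • x₁ + b • x₂ = D.A *ᵥ (a • x₁ + b • x₂) + D.B *ᵥ (a • u₁ + b • u₂) +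
      D.noiseMean P := by
    conv_lhs => rw [hs₁.mean_eq, hs₂.mean_eq]
    simp only [Matrix.mulVec_add, Matrix.mulVec_smul]
    obtain rfl : b = 1 - a := by linarith
    module
  obtain ⟨X, hX, hXj, hXr⟩ := exists_stabilizing_le hD hW hQ hR hSpsd hcov hmean
  have hQWQ : (D.Q * D.W P * D.Q).PosSemidef := by
    have := hW.posSemidef.mul_mul_transpose D.Q
    rwa [show D.Qᵀ = D.Q from hQ.isHermitian] at this
  refine ⟨X, hX, hXj.trans ?_, hXr.trans ?_⟩
  · rw [hj₁, hj₂]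
    have q1 := hQ.dotProduct_convex ha hb hab x₁ x₂
    have q2 := hR.posSemidef.dotProduct_convex ha hb hab u₁ u₂
    have q3 := hR.posSemidef.trace_mul_nonneg
      (posSemidef_mul_mul_transpose_convex ha hb hs₁.posSemidef hs₂.posSemidef hKS)
    rw [← hS] at q3
    simp only [Matrix.mul_sub, Matrix.mul_add, Matrix.mul_smul, Matrix.trace_sub,
      Matrix.trace_add, Matrix.trace_smul, smul_eq_mul] at q3
    have q4 : (D.Q * S).trace = a * (D.Q * S₁).trace + b * (D.Q * S₂).trace := by
      simp [hS, Matrix.mul_add]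
    simp only [costRate]
    linarith
  · rw [hr₁, hr₂]
    have q1 := hQWQ.dotProduct_convex ha hb hab x₁ x₂
    have q4 : (D.Q * D.W P * D.Q * S).trace = a * (D.Q * D.W P * D.Q * S₁).trace +
        b * (D.Q * D.W P * D.Q * S₂).trace := by
      simp [hS, Matrix.mul_add]
    have q5 : (a • x₁ + b • x₂) ⬝ᵥ D.Q *ᵥ D.M₃ P =
        a * (x₁ ⬝ᵥ D.Q *ᵥ D.M₃ P) + b * (x₂ ⬝ᵥ D.Q *ᵥ D.M₃ P) := by
      simp [add_dotProduct]
    simp only [riskRate]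
    linarith

/-- The risk is bounded below. -/
theorem exists_le_riskLim
    (hD : IsWhiteNoise P (fun t ω => D.w t ω - D.noiseMean P) (D.W P))
    (hW : (D.W P).PosDef) (hQ : D.Q.PosSemidef) (hR : D.R.PosDef)
    (hAQ : IsObservable D.A (psdSqrt D.Q)) :
    ∃ c : ℝ, ∀ X ∈ D.stabilizing, c ≤ D.riskLim P X := by
  obtain ⟨_, hst⟩ := exists_isStationary hD hW.posSemidef hQ hR hAQ
  obtain ⟨r, hr, hWr⟩ := hW.exists_mul_dotProduct_le
  have hQt : D.Qᵀ = D.Q := hQ.isHermitian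
  refine ⟨-(D.M₃ P ⬝ᵥ D.M₃ P) / r, fun X hX => ?_⟩
  obtain ⟨S, x, u, hs, -, hrisk, -⟩ := hst X hX
  have hQWQ : (D.Q * D.W P * D.Q).PosSemidef := by
    have := hW.posSemidef.mul_mul_transpose D.Q
    rwa [hQt] at this
  have h1 := hQWQ.trace_mul_nonneg hs.posSemidef
  have h2 : x ⬝ᵥ (D.Q * D.W P * D.Q) *ᵥ x = (D.Q *ᵥ x) ⬝ᵥ D.W P *ᵥ (D.Q *ᵥ x) := by
    rw [← Matrix.mulVec_mulVec, ← Matrix.mulVec_mulVec, Matrix.dotProduct_mulVec x,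
      ← Matrix.mulVec_transpose, hQt]
  have h3 : x ⬝ᵥ D.Q *ᵥ D.M₃ P = (D.Q *ᵥ x) ⬝ᵥ D.M₃ P := by
    rw [Matrix.dotProduct_mulVec x, ← Matrix.mulVec_transpose, hQt]
  have h4 := hWr (D.Q *ᵥ x)
  -- Completing the square in y = Qx: 4r|y|² + 4 y·M₃ ≥ -|M₃|²/r.
  have h5 := real_dotProduct_self_nonneg ((2 * r) • (D.Q *ᵥ x) + D.M₃ P)
  simp only [add_dotProduct, dotProduct_add, smul_dotProduct, dotProduct_smul, smul_eq_mul,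
    dotProduct_comm (D.M₃ P) (D.Q *ᵥ x)] at h5
  rw [hrisk, riskRate, h2, h3, div_le_iff₀ hr]
  nlinarith [mul_nonneg h1 hr.le, mul_le_mul_of_nonneg_right h4 hr.le]

/-- Policies of bounded cost subconverge to a policy of no larger cost and risk. -/
theorem exists_subseq_stabilizing
    (hD : IsWhiteNoise P (fun t ω => D.w t ω - D.noiseMean P) (D.W P))
    (hW : (D.W P).PosDef) (hQ : D.Q.PosSemidef) (hR : D.R.PosDef)
    (hAQ : IsObservable D.A (psdSqrt D.Q)) {X : ℕ → AffinePolicy n m}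
    (hX : ∀ i, X i ∈ D.stabilizing) {C : ℝ} (hC : ∀ i, D.costLim P (X i) ≤ C) :
    ∃ Y ∈ D.stabilizing, ∃ φ : ℕ → ℕ, StrictMono φ ∧ ∃ j r : ℝ,
      Tendsto (fun i => D.costLim P (X (φ i))) atTop (𝓝 j) ∧
      Tendsto (fun i => D.riskLim P (X (φ i))) atTop (𝓝 r) ∧
      D.costLim P Y ≤ j ∧ D.riskLim P Y ≤ r := by
  obtain ⟨c, hst⟩ := exists_isStationary hD hW.posSemidef hQ hR hAQ
  choose! S x u hs hcost hrisk hbd using hst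
  obtain ⟨r, hr, hRtr⟩ := hR.exists_mul_trace_le
  obtain ⟨r', hr', hRle⟩ := hR.exists_mul_dotProduct_le
  obtain ⟨w, hw, hWle⟩ := hW.exists_sq_entry_le
  set σ := D.noiseMean P ⬝ᵥ D.noiseMean P + (D.W P).trace
  have hj0 : ∀ i, 0 ≤ D.costLim P (X i) := fun i => by
    rw [hcost _ (hX i)]
    exact costRate_nonneg hQ hR _ (hs _ (hX i)).posSemidef _ _
  have hσ : 0 ≤ σ := add_nonneg (real_dotProduct_self_nonneg _) hW.posSemidef.trace_nonneg
  -- The constant c comes without a sign, hence the absolute value.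
  set E := |c| * (C + σ) with hE
  have hbdE : ∀ i, x (X i) ⬝ᵥ x (X i) + (S (X i)).trace ≤ E := fun i => by
    refine (hbd _ (hX i)).trans ?_
    exact mul_le_mul (le_abs_self c) (by linarith [hC i]) (by linarith [hj0 i]) (abs_nonneg c)
  have hSb : ∀ i a b, |S (X i) a b| ≤ E := fun i a b =>
    ((hs _ (hX i)).posSemidef.abs_apply_le_trace a b).trans
      (by linarith [hbdE i, real_dotProduct_self_nonneg (x (X i))])
  have hxb : ∀ i a, |x (X i) a| ≤ E + 1 := fun i a =>
    abs_apply_le_of_dotProduct_self_le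
      (by linarith [hbdE i, (hs _ (hX i)).posSemidef.trace_nonneg]) a
  have hparts : ∀ i, u (X i) ⬝ᵥ D.R *ᵥ u (X i) ≤ C ∧
      (D.R * ((X i).1 * S (X i) * (X i).1ᵀ)).trace ≤ C := fun i => by
    have h1 := hC i
    rw [hcost _ (hX i), costRate] at h1
    have h2 := hQ.dotProduct_nonneg (x (X i))
    have h3 := hQ.trace_mul_nonneg (hs _ (hX i)).posSemidef
    have h4 := hR.posSemidef.dotProduct_nonneg (u (X i))
    have h5 := hR.posSemidef.trace_mul_nonneg
      ((hs _ (hX i)).posSemidef.mul_mul_transpose (X i).1)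
    constructor <;> linarith
  have hub : ∀ i a, |u (X i) a| ≤ C / r' + 1 := fun i a =>
    abs_apply_le_of_dotProduct_self_le
      (by rw [le_div_iff₀ hr', mul_comm]; exact (hRle _).trans (hparts i).1) a
  -- The Lyapunov equation gives S ⪰ W, so r tr(K W Kᵀ) ≤ tr(R K S Kᵀ) ≤ C; positive definiteness of
  -- W then bounds every entry of K.
  have hKb : ∀ i a b, |(X i).1 a b| ≤ w * (C / r) + 1 := fun i a b => by
    have hsw : (S (X i) - D.W P).PosSemidef := by
      rw [(hs _ (hX i)).cov_eq, add_sub_cancel_right]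
      exact (hs _ (hX i)).posSemidef.mul_mul_transpose _
    have h1 := hR.posSemidef.trace_mul_nonneg (hsw.mul_mul_transpose (X i).1)
    simp only [Matrix.mul_sub, Matrix.sub_mul, Matrix.trace_sub] at h1
    have h2 := hRtr _ (hW.posSemidef.mul_mul_transpose (X i).1)
    have h3 : ((X i).1 * D.W P * (X i).1ᵀ).trace ≤ C / r := by
      rw [le_div_iff₀ hr, mul_comm]
      linarith [(hparts i).2]
    have h4 := (hWle _ (X i).1 a b).trans (mul_le_mul_of_nonneg_left h3 hw.le)
    rw [abs_le]
    constructor <;> nlinarith [sq_nonneg ((X i).1 a b - 1), sq_nonneg ((X i).1 a b + 1)]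
  let T := (Fin m → Fin n → ℝ) × (Fin n → Fin n → ℝ) × (Fin n → ℝ) × (Fin m → ℝ)
  let p : ℕ → T := fun i => ((X i).1, S (X i), x (X i), u (X i))
  let M : T := (fun _ _ => w * (C / r) + 1, fun _ _ => E, fun _ => E + 1, fun _ => C / r' + 1)
  have hp : ∀ i, p i ∈ Set.Icc (-M) M := fun i =>
    ⟨⟨fun a b => (abs_le.1 (hKb i a b)).1, fun a b => (abs_le.1 (hSb i a b)).1,
      fun a => (abs_le.1 (hxb i a)).1, fun a => (abs_le.1 (hub i a)).1⟩,
      ⟨fun a b => (abs_le.1 (hKb i a b)).2, fun a b => (abs_le.1 (hSb i a b)).2,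
      fun a => (abs_le.1 (hxb i a)).2, fun a => (abs_le.1 (hub i a)).2⟩⟩
  obtain ⟨K', S', x', u', φ, hφ, hlim⟩ : ∃ (K' : Matrix (Fin m) (Fin n) ℝ)
      (S' : Matrix (Fin n) (Fin n) ℝ) (x' : Fin n → ℝ) (u' : Fin m → ℝ) (φ : ℕ → ℕ),
      StrictMono φ ∧ Tendsto (fun i => ((X (φ i)).1, S (X (φ i)), x (X (φ i)), u (X (φ i)))) atTop
        (𝓝 (K', S', x', u')) := by
    obtain ⟨q, -, φ, hφ, hlim⟩ :=
      (isCompact_Icc : IsCompact (Set.Icc (-M) M)).tendsto_subseq hp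
    exact ⟨q.1, q.2.1, q.2.2.1, q.2.2.2, φ, hφ, hlim⟩
  have hS'psd : S'.PosSemidef :=
    Matrix.PosSemidef.of_tendsto
      (((continuous_fst.comp continuous_snd).tendsto _).comp hlim :
        Tendsto (fun i => S (X (φ i))) atTop (𝓝 S')) fun i => (hs _ (hX _)).posSemidef
  have hcov : S' = (D.A - D.B * K') * S' * (D.A - D.B * K')ᵀ + D.W P := by
    have h1 : Continuous fun q : Matrix (Fin m) (Fin n) ℝ ×
        Matrix (Fin n) (Fin n) ℝ × (Fin n → ℝ) × (Fin m → ℝ) => q.2.1 := by fun_prop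
    have h2 : Continuous fun q : Matrix (Fin m) (Fin n) ℝ ×
        Matrix (Fin n) (Fin n) ℝ × (Fin n → ℝ) × (Fin m → ℝ) =>
        (D.A - D.B * q.1) * q.2.1 * (D.A - D.B * q.1)ᵀ + D.W P := by fun_prop
    refine tendsto_nhds_unique ((h1.tendsto _).comp hlim) (((h2.tendsto _).comp hlim).congr
      fun i => ?_)
    exact (hs _ (hX (φ i))).cov_eq.symm
  have hmean : x' = D.A *ᵥ x' + D.B *ᵥ u' + D.noiseMean P := by
    have h1 : Continuous fun q : Matrix (Fin m) (Fin n) ℝ ×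
        Matrix (Fin n) (Fin n) ℝ × (Fin n → ℝ) × (Fin m → ℝ) => q.2.2.1 := by fun_prop
    have h2 : Continuous fun q : Matrix (Fin m) (Fin n) ℝ ×
        Matrix (Fin n) (Fin n) ℝ × (Fin n → ℝ) × (Fin m → ℝ) =>
        D.A *ᵥ q.2.2.1 + D.B *ᵥ q.2.2.2 + D.noiseMean P := by fun_prop
    refine tendsto_nhds_unique ((h1.tendsto _).comp hlim) (((h2.tendsto _).comp hlim).congr
      fun i => ?_)
    exact (hs _ (hX (φ i))).mean_eq.symm
  -- The Lyapunov equation survives the limit, and with W ≻ 0 it makes the limiting gain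
  -- stabilizing, although the set of stabilizing policies is not closed in general.
  obtain ⟨Y, hY, hYj, hYr⟩ := exists_stabilizing_le hD hW hQ hR (K := K') hS'psd
    (by rw [sub_sub, ← hcov, sub_self]; exact Matrix.PosSemidef.zero) hmean
  refine ⟨Y, hY, φ, hφ, _, _, ?_, ?_, hYj, hYr⟩
  · have h1 : Continuous fun q : Matrix (Fin m) (Fin n) ℝ ×
        Matrix (Fin n) (Fin n) ℝ × (Fin n → ℝ) × (Fin m → ℝ) => D.costRate q.1 q.2.1 q.2.2.1 q.2.2.2 := by
      unfold costRate
      fun_prop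
    exact ((h1.tendsto _).comp hlim).congr fun i => (hcost _ (hX (φ i))).symm
  · have h1 : Continuous fun q : Matrix (Fin m) (Fin n) ℝ ×
        Matrix (Fin n) (Fin n) ℝ × (Fin n → ℝ) × (Fin m → ℝ) => D.riskRate P q.2.1 q.2.2.1 := by
      unfold riskRate
      fun_prop
    exact ((h1.tendsto _).comp hlim).congr fun i => (hrisk _ (hX (φ i))).symm

end RCLQRData

/-! ### Duality for two real functions and one constraint. -/

section ScalarDuality

variable {ι : Type*} {j g : ι → ℝ}

/-- Sequential inf-compactness of the pair `(j, g)` on the sublevel sets of `j`. -/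
def SubseqCompact (j g : ι → ℝ) : Prop :=
  ∀ (x : ℕ → ι) (C : ℝ), (∀ i, j (x i) ≤ C) → ∃ y, ∃ φ : ℕ → ℕ, StrictMono φ ∧ ∃ a b : ℝ,
    Tendsto (fun i => j (x (φ i))) atTop (𝓝 a) ∧ Tendsto (fun i => g (x (φ i))) atTop (𝓝 b) ∧
    j y ≤ a ∧ g y ≤ b

/-- The pairs `(j x, g x)` are convex up to domination. -/
def ConvexlikePair (j g : ι → ℝ) : Prop :=
  ∀ (x y : ι) (a b : ℝ), 0 ≤ a → 0 ≤ b → a + b = 1 →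
    ∃ z, j z ≤ a * j x + b * j y ∧ g z ≤ a * g x + b * g y

/-- Along a minimizing sequence of j + μ g, the lower bound on g keeps j bounded, so compactness in
the sublevel sets of j suffices. -/
theorem SubseqCompact.exists_minimizer [Nonempty ι] (h : SubseqCompact j g)
    (hj : ∀ x, 0 ≤ j x) {c : ℝ} (hg : ∀ x, c ≤ g x) {μ : ℝ} (hμ : 0 ≤ μ) :
    ∃ y, ∀ x, j y + μ * g y ≤ j x + μ * g x := by
  set f := fun x => j x + μ * g x with hf
  have hlow : ∀ x, j x + μ * c ≤ f x := fun x => by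
    have := mul_le_mul_of_nonneg_left (hg x) hμ
    simp only [hf]
    linarith
  have hbdd : BddBelow (Set.range f) := by
    refine ⟨μ * c, ?_⟩
    rintro _ ⟨x, rfl⟩
    linarith [hlow x, hj x]
  obtain ⟨v, hanti, hlim, hmem⟩ := exists_seq_tendsto_sInf (Set.range_nonempty f) hbdd
  choose x hx using hmem
  obtain ⟨y, φ, hφ, a, b, ha, hb, hja, hgb⟩ := h x (v 0 - μ * c) fun i => by
    have h1 := hlow (x i)
    have h2 := hanti (Nat.zero_le i)
    rw [hx] at h1
    linarith
  have h1 : Tendsto (fun i => f (x (φ i))) atTop (𝓝 (a + μ * b)) := ha.add (hb.const_mul μ)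
  have h2 : Tendsto (fun i => f (x (φ i))) atTop (𝓝 (sInf (Set.range f))) := by
    simp only [hx]
    exact hlim.comp hφ.tendsto_atTop
  have h3 := tendsto_nhds_unique h1 h2
  refine ⟨y, fun z => ?_⟩
  have h4 := csInf_le hbdd (Set.mem_range_self z)
  have h5 := mul_le_mul_of_nonneg_left hgb hμ
  simp only [hf] at h4 h3
  linarith

/-- A minimizing sequence of feasible points has g-limit at most 0, and the point supplied by
compactness is dominated by the limits, so it stays feasible. -/
theorem SubseqCompact.exists_constrained_minimizer (h : SubseqCompact j g)
    (hj : ∀ x, 0 ≤ j x) (hne : ∃ x, g x ≤ 0) :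
    ∃ y, g y ≤ 0 ∧ ∀ x, g x ≤ 0 → j y ≤ j x := by
  have hbdd : BddBelow (j '' {x | g x ≤ 0}) := by
    refine ⟨0, ?_⟩
    rintro _ ⟨x, -, rfl⟩
    exact hj x
  have hne' : (j '' {x | g x ≤ 0}).Nonempty := Set.Nonempty.image j hne
  obtain ⟨v, hanti, hlim, hmem⟩ := exists_seq_tendsto_sInf hne' hbdd
  choose x hxg hx using hmem
  obtain ⟨y, φ, hφ, a, b, ha, hb, hja, hgb⟩ := h x (v 0) fun i => by
    rw [hx]
    exact hanti (Nat.zero_le i)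
  have h2 : Tendsto (fun i => j (x (φ i))) atTop (𝓝 (sInf (j '' {x | g x ≤ 0}))) := by
    simp only [hx]
    exact hlim.comp hφ.tendsto_atTop
  obtain rfl := tendsto_nhds_unique ha h2
  exact ⟨y, hgb.trans (le_of_tendsto' hb fun i => hxg _), fun z hz =>
    hja.trans (csInf_le hbdd (Set.mem_image_of_mem j hz))⟩

/-- Lagrange duality with one constraint, under Slater's condition. -/
theorem ConvexlikePair.exists_multiplier (h : ConvexlikePair j g) {p : ℝ}
    (hp : ∀ x, g x ≤ 0 → p ≤ j x) (hslater : ∃ x, g x < 0) :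
    ∃ μ : ℝ, 0 ≤ μ ∧ ∀ x, p ≤ j x + μ * g x := by
  -- A multiplier must exceed every slope (p - j)/g where g > 0 and stay below every (j - p)/(-g)
  -- where g < 0; the supremum of the former works. Including 0 makes it nonnegative and keeps the
  -- set nonempty.
  set U : Set ℝ := {s | s = 0 ∨ ∃ x, 0 < g x ∧ s = (p - j x) / g x} with hU
  have hub : ∀ x, g x < 0 → ∀ s ∈ U, s ≤ (j x - p) / (-g x) := by
    rintro x hx s (rfl | ⟨y, hy, rfl⟩)
    · exact div_nonneg (by linarith [hp x hx.le]) (by linarith)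
    · have hd : 0 < g y - g x := by linarith
      -- The weights make the combination of g x and g y vanish, so z is feasible.
      obtain ⟨z, hz1, hz2⟩ := h x y (g y / (g y - g x)) (-g x / (g y - g x))
        (div_nonneg hy.le hd.le) (div_nonneg (by linarith) hd.le) (by field_simp; ring)
      have hgz : g z ≤ 0 := hz2.trans_eq (by field_simp; ring)
      have h1 := (hp z hgz).trans hz1
      have h2 : g y / (g y - g x) * j x + -g x / (g y - g x) * j y =
          (g y * j x - g x * j y) / (g y - g x) := by ring
      rw [h2, le_div_iff₀ hd] at h1
      rw [div_le_div_iff₀ hy (by linarith)]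
      linarith
  obtain ⟨x₀, hx₀⟩ := hslater
  -- Slater's point is what keeps the multiplier finite.
  have hbdd : BddAbove U := ⟨_, hub x₀ hx₀⟩
  have h0 : (0 : ℝ) ∈ U := Or.inl rfl
  refine ⟨sSup U, le_csSup hbdd h0, fun x => ?_⟩
  rcases lt_trichotomy (g x) 0 with hx | hx | hx
  · have h1 := csSup_le ⟨0, h0⟩ (hub x hx)
    rw [le_div_iff₀ (by linarith)] at h1
    linarith
  · rw [hx, mul_zero, add_zero]
    exact hp x hx.le
  · have h1 := le_csSup hbdd (Or.inr ⟨x, hx, rfl⟩ : (p - j x) / g x ∈ U)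
    rw [div_le_iff₀ hx] at h1
    linarith

end ScalarDuality

/-! ### Assembly of the duality theorem. -/

namespace RCLQRData

variable {n m : ℕ} {Ω : Type*} [MeasurableSpace Ω] {D : RCLQRData n m Ω} {P : Measure Ω}
  [IsProbabilityMeasure P]

theorem lagrangian_eq
    (hD : IsWhiteNoise P (fun t ω => D.w t ω - D.noiseMean P) (D.W P))
    (hW : (D.W P).PosSemidef) {X : AffinePolicy n m} (hX : X ∈ D.stabilizing) (μ : ℝ) :
    D.lagrangian P X μ =
      ((D.costLim P X + μ * (D.riskLim P X - D.rhoBar P) : ℝ) : EReal) := by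
  rw [lagrangian, J_eq hD hW hX, Jc_eq hD hW hX]
  push_cast
  rfl

end RCLQRData

end

theorem theorem2 {n m : ℕ} {Ω : Type*} [MeasurableSpace Ω] (P : Measure Ω)
    [IsProbabilityMeasure P] (D : RCLQRData n m Ω)
    -- the noise is i.i.d. with finite fourth moment and positive definite covariance
    (hw_meas : ∀ t, Measurable (D.w t))
    (hw_indep : iIndepFun D.w P)
    (hw_ident : ∀ t, IdentDistrib (D.w t) (D.w 0) P P)
    (hw_moment : MemLp (D.w 0) 4 P)
    (hW : (D.W P).PosDef)
    -- the standing assumptions on the system and the weights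
    (hQ : D.Q.PosSemidef)
    (hR : D.R.PosDef)
    (hAB : IsControllable D.A D.B)
    (hAQ : IsObservable D.A (psdSqrt D.Q))
    (hρ : 0 < D.ρ)
    -- Slater's condition
    (hSlater : ∃ X ∈ D.stabilizing, D.Jc P X < (D.rhoBar P : EReal)) :
    -- the limits defining `J` and `J_c` exist and are finite for stabilizing policies
    (∀ X ∈ D.stabilizing, ∃ j c : ℝ,
      Tendsto (D.avgCost P X) atTop (𝓝 j) ∧ Tendsto (D.avgRisk P X) atTop (𝓝 c)) ∧
    -- the minimum in the definition of the dual function is attained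
    (∀ μ : ℝ, 0 ≤ μ → ∃ X ∈ D.stabilizing, D.lagrangian P X μ = D.dualFun P μ) ∧
    -- zero duality gap, with both optimal values attained
    D.primalValue P = D.dualValue P ∧
    (∃ X ∈ D.stabilizing, D.Jc P X ≤ (D.rhoBar P : EReal) ∧ D.J P X = D.primalValue P) ∧
    (∃ μ : ℝ, 0 ≤ μ ∧ D.dualFun P μ = D.dualValue P) := by
  have hD := D.isWhiteNoise hw_meas hw_indep hw_ident (hw_moment.mono_exponent (by norm_num))
  have hWs := hW.posSemidef
  let j : D.stabilizing → ℝ := fun X => D.costLim P X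
  let g : D.stabilizing → ℝ := fun X => D.riskLim P X - D.rhoBar P
  have hj : ∀ X, 0 ≤ j X := fun X => ge_of_tendsto' (RCLQRData.tendsto_avgCost hD hWs X.2)
    fun T => RCLQRData.avgCost_nonneg hD hWs hQ hR X T
  obtain ⟨c, hc⟩ := RCLQRData.exists_le_riskLim hD hW hQ hR hAQ
  have hg : ∀ X, c - D.rhoBar P ≤ g X := fun X => sub_le_sub_right (hc X X.2) _
  have hcpt : SubseqCompact j g := fun X C hC => by
    obtain ⟨Y, hY, φ, hφ, a, b, ha, hb, hYa, hYb⟩ :=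
      RCLQRData.exists_subseq_stabilizing hD hW hQ hR hAQ (fun i => (X i).2) hC
    exact ⟨⟨Y, hY⟩, φ, hφ, a, b - D.rhoBar P, ha, hb.sub_const _, hYa, sub_le_sub_right hYb _⟩
  have hconv : ConvexlikePair j g := fun X Y a b ha hb hab => by
    obtain ⟨Z, hZ, hZj, hZr⟩ :=
      RCLQRData.exists_stabilizing_convex hD hW hQ hR hAQ X.2 Y.2 ha hb hab
    refine ⟨⟨Z, hZ⟩, hZj, ?_⟩
    have : b = 1 - a := by linarith
    subst this
    simp only [g]
    linarith
  obtain ⟨X₀, hX₀, hX₀s⟩ := hSlater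
  rw [RCLQRData.Jc_eq hD hWs hX₀, EReal.coe_lt_coe_iff] at hX₀s
  have hslater : ∃ X, g X < 0 := ⟨⟨X₀, hX₀⟩, sub_neg.2 hX₀s⟩
  have hlag : ∀ (X : D.stabilizing) (μ : ℝ),
      D.lagrangian P X μ = ((j X + μ * g X : ℝ) : EReal) := fun X μ =>
    RCLQRData.lagrangian_eq hD hWs X.2 μ
  have : Nonempty D.stabilizing := ⟨⟨X₀, hX₀⟩⟩
  have hmin : ∀ μ : ℝ, 0 ≤ μ → ∃ X ∈ D.stabilizing, D.lagrangian P X μ = D.dualFun P μ := by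
    intro μ hμ
    obtain ⟨Y, hY⟩ := hcpt.exists_minimizer hj hg hμ
    refine ⟨Y, Y.2, le_antisymm (le_iInf₂ fun X hX => ?_) (iInf₂_le Y.1 Y.2)⟩
    rw [hlag Y, hlag ⟨X, hX⟩]
    exact EReal.coe_le_coe_iff.2 (hY ⟨X, hX⟩)
  obtain ⟨Y, hYg, hYj⟩ := hcpt.exists_constrained_minimizer hj
    (hslater.imp fun _ h => h.le)
  obtain ⟨μ, hμ, hmult⟩ := hconv.exists_multiplier hYj hslater
  have hYfeas : D.Jc P Y ≤ (D.rhoBar P : EReal) := by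
    rw [RCLQRData.Jc_eq hD hWs Y.2, EReal.coe_le_coe_iff]
    exact sub_nonpos.1 hYg
  have hprimal : D.J P Y = D.primalValue P := by
    refine le_antisymm (le_iInf₂ fun X hX => ?_) (iInf₂_le Y.1 hYfeas)
    -- A feasible policy either has infinite cost or is stabilizing, so the minimizer over
    -- stabilizing policies is optimal among all affine ones.
    rcases eq_or_ne (D.J P X) ⊤ with htop | htop
    · rw [htop]
      exact le_top
    have hXs := RCLQRData.mem_stabilizing_of_J_lt_top hD hW hQ hR hAQ htop.lt_top
    rw [RCLQRData.J_eq hD hWs Y.2, RCLQRData.J_eq hD hWs hXs, EReal.coe_le_coe_iff]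
    refine hYj ⟨X, hXs⟩ (sub_nonpos.2 ?_)
    rw [Set.mem_ofPred_eq, RCLQRData.Jc_eq hD hWs hXs, EReal.coe_le_coe_iff] at hX
    exact hX
  have hweak : D.dualValue P ≤ D.J P Y := by
    refine iSup₂_le fun ν hν => (iInf₂_le Y.1 Y.2).trans ?_
    rw [hlag Y, RCLQRData.J_eq hD hWs Y.2, EReal.coe_le_coe_iff]
    have := mul_nonpos_of_nonneg_of_nonpos (Set.mem_Ici.1 hν) hYg
    simp only [j]
    linarith
  have hstrong : D.J P Y ≤ D.dualFun P μ := by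
    refine le_iInf₂ fun X hX => ?_
    rw [hlag ⟨X, hX⟩, RCLQRData.J_eq hD hWs Y.2, EReal.coe_le_coe_iff]
    exact hmult ⟨X, hX⟩
  have hdual : D.dualFun P μ ≤ D.dualValue P :=
    le_iSup₂ (f := fun ν (_ : ν ∈ Set.Ici (0 : ℝ)) => D.dualFun P ν) μ hμ
  refine ⟨fun X hX => ⟨_, _, RCLQRData.tendsto_avgCost hD hWs hX,
    RCLQRData.tendsto_avgRisk hD hWs hX⟩, hmin, ?_, ⟨Y, Y.2, hYfeas, hprimal⟩, μ, hμ, ?_⟩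
  · rw [← hprimal]
    exact le_antisymm (hstrong.trans hdual) hweak
  · exact le_antisymm hdual (hweak.trans hstrong)
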